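/- **Proposition.** Let $S$ be a finite set. *Trees.* An *$S$-labeled tree* is a finite rooted tree $T$ together with an assignment to each vertex $v$ of a set $lb(v)\subset S$ of labels such that $S=\bigsqcup_{v}lb(v)$ and every vertex satisfies $|\{\text{children of }v\}|+|lb(v)|\ge 2$. A vertex $w\ne v$ is an *ancestor* of $v$ (and $v$ a *descendant* of $w$) if the path from $v$ to the root passes through $w$. An *$S$-labeled RBW-tree* is an $S$-labeled tree with a color $R$, $B$ or $W$ (red, blue, white) on each vertex such that all descendants of an $R$-vertex are $R$, all ancestors of a $B$-vertex are $B$, and no $W$-vertex is an ancestor of another $W$-vertex. Trees are considered up to isomorphism preserving edges, root, labels and colors. *Contractions.* For a set $E$ of edges of an $S$-labeled tree $T$, contracting each connected component of the union of $E$ to a vertex, which receives the union of the labels of the vertices contracted to it, gives an $S$-labeled tree $T/E$ and a surjection $V(T)\to V(T/E)$. A *contraction* $\mathfrak c:T\to T'$ of RBW-trees is an identification of $S$-labeled trees $T'=T/E$ for some $E$ such that every vertex of $T$ that is sent to an $R$-vertex (resp. $B$-vertex) of $T'$ is itself an $R$-vertex (resp. $B$-vertex). It is *trivial* if $E=\emptyset$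 and no color changes. Setting $T\le T'$ when there is a contraction $T\to T'$ makes the $S$-labeled RBW-trees a poset. For a contraction $\mathfrak c:T\to T'$ let $$\mathcal P_{\mathfrak c}=(T,T']=\{T''\mid T<T''\le T'\}$$ be the poset of nontrivial intermediate contractions, and let $\mathrm{Codim}(\mathfrak c)=\mathrm{Codim}(T)-\mathrm{Codim}(T')$, where $\mathrm{Codim}(T)$ is the number of vertices of $T$ of color $R$ or $B$. *CW-complexes.* A CW-complex is *regular* if the attaching map of every cell of positive dimension is a homeomorphism onto its image and this image is a subcomplex. Its *face poset* is the set of its cells, ordered by inclusion of closed cells. *Claim.* For every nontrivial contraction $\mathfrak c:T\to T'$ of $S$-labeled RBW-trees, $\mathcal P_{\mathfrak c}$ is isomorphic to the face poset of a regular CW-complex homeomorphic to a closed ball of dimension $\mathrm{Codim}(\mathfrak c)-1$. -/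

import Mathlib

namespace RBW

/-! ### Rooted trees with labels -/

/-- In the tree `G` with root `r`, the vertex `w` is an ancestor of `v`
(and `v` is a descendant of `w`): `w ≠ v`, and the path from `v` to `r` passes through `w`. -/
def IsAncestor {V : Type} (G : SimpleGraph V) (r w v : V) : Prop :=
  v ≠ w ∧ ∃ p : G.Walk v r, p.IsPath ∧ w ∈ p.support

/-- `v` is a child of `w`: `w` is an ancestor of `v` that is adjacent to `v`. -/
def IsChild {V : Type} (G : SimpleGraph V) (r v w : V) : Prop :=
  IsAncestor G r w v ∧ G.Adj v w

universe u

/-- An `S`-labeled tree: a finite rooted tree whose vertices carry pairwise disjoint sets of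
labels that exhaust `S`, such that the children and the labels of any vertex are together
at least two in number. -/
structure LabeledTree (S : Type u) where
  V : Type
  finite_V : Finite V
  graph : SimpleGraph V
  isTree : graph.IsTree
  root : V
  lb : V → Set S
  lb_disjoint : ∀ v w, v ≠ w → Disjoint (lb v) (lb w)
  lb_cover : ⋃ v, lb v = Set.univ
  stable : ∀ v, 2 ≤ {w | IsChild graph root w v}.ncard + (lb v).ncard

/-- A contraction `T → T'` of `S`-labeled trees. It consists of a set `edges` of edges of `T`
and a map `map` on vertices that presents `T'` as the tree obtained from `T` by contracting each
connected component of the union of `edges` to one vertex. -/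
structure Contraction {S : Type u} (T T' : LabeledTree S) where
  edges : Set (Sym2 T.V)
  edges_subset : edges ⊆ T.graph.edgeSet
  map : T.V → T'.V
  map_surjective : Function.Surjective map
  map_eq_iff : ∀ u v, map u = map v ↔ (SimpleGraph.fromEdgeSet edges).Reachable u v
  adj_iff : ∀ a b, T'.graph.Adj a b ↔
    a ≠ b ∧ ∃ u v, T.graph.Adj u v ∧ map u = a ∧ map v = b
  map_root : map T.root = T'.root
  lb_eq : ∀ w, T'.lb w = ⋃ v ∈ {v | map v = w}, T.lb v

/-! ### Three-colored trees -/

/-- The three colors red, blue and white. -/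
inductive Color where
  | R : Color
  | B : Color
  | W : Color

/-- An `S`-labeled RBW-tree, that is, an `S`-labeled tree with a legal coloring. -/
structure RBWTree (S : Type u) extends LabeledTree S where
  color : V → Color
  red_descendants : ∀ v w, IsAncestor graph root v w → color v = Color.R → color w = Color.R
  blue_ancestors : ∀ v w, IsAncestor graph root v w → color w = Color.B → color v = Color.B
  white_incomparable : ∀ v w, IsAncestor graph root v w →
    ¬ (color v = Color.W ∧ color w = Color.W)

/-- An RBW-contraction: a contraction of the underlying labeled trees such that all vertices
contracted to a red (blue) vertex are red (blue). -/
structure RBWContraction {S : Type u} (T T' : RBWTree S) extends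
    Contraction T.toLabeledTree T'.toLabeledTree where
  red_fiber : ∀ v, T'.color (map v) = Color.R → T.color v = Color.R
  blue_fiber : ∀ v, T'.color (map v) = Color.B → T.color v = Color.B

/-- Two colored labeled trees are the same `S`-labeled RBW-tree if there is a bijection between
their vertices that preserves edges, root, labels and colors. -/
def IsIso {S : Type u} (T T' : RBWTree S) : Prop :=
  ∃ e : T.V ≃ T'.V, (∀ u v, T'.graph.Adj (e u) (e v) ↔ T.graph.Adj u v) ∧
    e T.root = T'.root ∧ (∀ v, T'.lb (e v) = T.lb v) ∧ (∀ v, T'.color (e v) = T.color v)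

theorem IsIso.refl {S : Type u} (T : RBWTree S) : IsIso T T :=
  ⟨Equiv.refl _, by simp⟩

theorem IsIso.symm {S : Type u} {T T' : RBWTree S} (h : IsIso T T') : IsIso T' T := by
  obtain ⟨e, h1, h2, h3, h4⟩ := h
  refine ⟨e.symm, fun u v => ?_, ?_, fun v => ?_, fun v => ?_⟩
  · rw [← h1]; simp
  · rw [← h2]; simp
  · rw [← h3]; simp
  · rw [← h4]; simp

theorem IsIso.trans {S : Type u} {T T' T'' : RBWTree S} (h : IsIso T T') (k : IsIso T' T'') :
    IsIso T T'' := by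
  obtain ⟨e, h1, h2, h3, h4⟩ := h
  obtain ⟨f, k1, k2, k3, k4⟩ := k
  exact ⟨e.trans f, by simp [h1, k1], by simp [h2, k2], by simp [h3, k3], by simp [h4, k4]⟩

instance rbwSetoid (S : Type u) : Setoid (RBWTree S) where
  r := IsIso
  iseqv := ⟨IsIso.refl, IsIso.symm, IsIso.trans⟩

/-- An isomorphism is a contraction along the empty set of edges. -/
theorem IsIso.contraction {S : Type u} {T T' : RBWTree S} (h : IsIso T T') :
    Nonempty (RBWContraction T T') := by
  obtain ⟨e, h1, h2, h3, h4⟩ := h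
  refine ⟨⟨⟨∅, by simp, e, e.surjective, fun u v => ?_, fun a b => ?_, h2, fun w => ?_⟩,
    fun v => ?_, fun v => ?_⟩⟩
  · simp
  · constructor
    · intro hab
      refine ⟨hab.ne, e.symm a, e.symm b, ?_, by simp, by simp⟩
      rw [← h1]; simpa using hab
    · rintro ⟨-, u, v, huv, rfl, rfl⟩
      exact (h1 u v).2 huv
  · ext s
    obtain ⟨v, rfl⟩ := e.surjective w
    simp [h3]
  · rw [h4]; exact id
  · rw [h4]; exact id

/-- Contractions compose. -/
theorem RBWContraction.comp {S : Type u} {T T' T'' : RBWTree S} (c : RBWContraction T T')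
    (d : RBWContraction T' T'') : Nonempty (RBWContraction T T'') := by
  set E : Set (Sym2 T.V) :=
    {e | e ∈ T.graph.edgeSet ∧ ∀ u v, e = s(u, v) → d.map (c.map u) = d.map (c.map v)} with hE
  have memE : ∀ u v, T.graph.Adj u v → d.map (c.map u) = d.map (c.map v) → s(u, v) ∈ E := by
    intro u v huv h
    refine ⟨huv, fun a b hab => ?_⟩
    rcases Sym2.eq_iff.1 hab with ⟨rfl, rfl⟩ | ⟨rfl, rfl⟩
    · exact h
    · exact h.symm
  have hle : SimpleGraph.fromEdgeSet c.edges ≤ SimpleGraph.fromEdgeSet E := by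
    intro u v huv
    have hr := (c.map_eq_iff u v).2 huv.reachable
    rw [SimpleGraph.fromEdgeSet_adj] at huv ⊢
    exact ⟨memE u v (c.edges_subset huv.1) (by rw [hr]), huv.2⟩
  have lift : ∀ a b, (SimpleGraph.fromEdgeSet d.edges).Reachable a b →
      ∀ u v, c.map u = a → c.map v = b → (SimpleGraph.fromEdgeSet E).Reachable u v := by
    rintro a b ⟨p⟩
    induction p with
    | nil =>
      intro u v hu hv
      exact ((c.map_eq_iff u v).1 (hu.trans hv.symm)).mono hle
    | @cons a b' b hab p ih =>
      intro u v hu hv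
      have hr := (d.map_eq_iff _ _).2 hab.reachable
      rw [SimpleGraph.fromEdgeSet_adj] at hab
      obtain ⟨-, x, y, hxy, rfl, rfl⟩ := (c.adj_iff _ _).1 (d.edges_subset hab.1)
      have h1 := ((c.map_eq_iff u x).1 hu).mono hle
      have h2 : (SimpleGraph.fromEdgeSet E).Adj x y := by
        rw [SimpleGraph.fromEdgeSet_adj]
        exact ⟨memE x y hxy hr, hxy.ne⟩
      exact h1.trans (h2.reachable.trans (ih y v rfl hv))
  refine ⟨⟨⟨E, fun e he => he.1, d.map ∘ c.map, d.map_surjective.comp c.map_surjective,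
    fun u v => ⟨fun h => ?_, fun h => ?_⟩, fun a b => ⟨fun h => ?_, fun h => ?_⟩, ?_,
    fun w => ?_⟩, fun v h => ?_, fun v h => ?_⟩⟩
  · exact lift _ _ ((d.map_eq_iff _ _).1 h) u v rfl rfl
  · obtain ⟨p⟩ := h
    induction p with
    | nil => rfl
    | cons hab p ih =>
      rw [SimpleGraph.fromEdgeSet_adj] at hab
      exact (hab.1.2 _ _ rfl).trans ih
  · obtain ⟨hne, x, y, hxy, rfl, rfl⟩ := (d.adj_iff _ _).1 h
    obtain ⟨-, u, v, huv, rfl, rfl⟩ := (c.adj_iff _ _).1 hxy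
    exact ⟨hne, u, v, huv, rfl, rfl⟩
  · obtain ⟨hne, u, v, huv, rfl, rfl⟩ := h
    refine (d.adj_iff _ _).2 ⟨hne, c.map u, c.map v, (c.adj_iff _ _).2 ⟨?_, u, v, huv, rfl, rfl⟩,
      rfl, rfl⟩
    intro h
    exact hne (by simp [h])
  · simp [c.map_root, d.map_root]
  · ext s
    simp [d.lb_eq, c.lb_eq]
  · exact c.red_fiber v (d.red_fiber _ h)
  · exact c.blue_fiber v (d.blue_fiber _ h)

/-- Contractions in both directions exist only between isomorphic trees. -/
theorem RBWContraction.antisymm {S : Type u} {T T' : RBWTree S} (c : RBWContraction T T')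
    (d : RBWContraction T' T) : IsIso T T' := by
  have := T.finite_V
  have := T'.finite_V
  have hs : Function.Surjective (d.map ∘ c.map) := d.map_surjective.comp c.map_surjective
  have hi : Function.Injective (d.map ∘ c.map) := Finite.injective_iff_surjective.2 hs
  have hc : Function.Injective c.map := hi.of_comp
  have key : ∀ C : Color, (∀ v, T'.color (c.map v) = C → T.color v = C) →
      (∀ v, T.color (d.map v) = C → T'.color v = C) →
      ∀ v, T.color v = C → T'.color (c.map v) = C := by
    intro C h1 h2 v hv
    have hsub : (d.map ∘ c.map) ⁻¹' {v | T.color v = C} ⊆ {v | T.color v = C} :=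
      fun w hw => h1 w (h2 _ hw)
    have hcard : ((d.map ∘ c.map) ⁻¹' {v | T.color v = C}).ncard = {v | T.color v = C}.ncard :=
      Set.ncard_preimage_of_injective_subset_range hi (by simp [hs.range_eq])
    have heq := Set.eq_of_subset_of_ncard_le hsub hcard.ge (Set.toFinite _)
    have hmem : v ∈ (d.map ∘ c.map) ⁻¹' {v | T.color v = C} := by rw [heq]; exact hv
    exact h2 _ hmem
  refine ⟨Equiv.ofBijective c.map ⟨hc, c.map_surjective⟩, fun u v => ?_, c.map_root,
    fun v => ?_, fun v => ?_⟩
  · change T'.graph.Adj (c.map u) (c.map v) ↔ _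
    rw [c.adj_iff]
    constructor
    · rintro ⟨-, x, y, hxy, hx, hy⟩
      rwa [hc hx, hc hy] at hxy
    · intro h
      exact ⟨fun e => h.ne (hc e), u, v, h, rfl, rfl⟩
  · change T'.lb (c.map v) = _
    ext s
    simp [c.lb_eq, hc.eq_iff]
  · change T'.color (c.map v) = _
    have hR := key Color.R c.red_fiber d.red_fiber v
    have hB := key Color.B c.blue_fiber d.blue_fiber v
    have hR' := c.red_fiber v
    have hB' := c.blue_fiber v
    cases h : T.color v <;> cases h' : T'.color (c.map v) <;> simp_all

/-- The poset of `S`-labeled RBW-trees (up to isomorphism), ordered by RBW-contractions: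
`T ≤ T'` if there is an RBW-contraction from `T` to `T'`. -/
def TreePoset (S : Type u) := Quotient (rbwSetoid S)

/-- The element of the poset given by a tree. -/
def TreePoset.mk {S : Type u} (T : RBWTree S) : TreePoset S := Quotient.mk (rbwSetoid S) T

instance (S : Type u) : PartialOrder (TreePoset S) where
  le := Quotient.lift₂ (fun T T' => Nonempty (RBWContraction T T')) (by
    intro a b a' b' (ha : IsIso a a') (hb : IsIso b b')
    refine propext ⟨fun ⟨c⟩ => ?_, fun ⟨c⟩ => ?_⟩
    · obtain ⟨x⟩ := ha.symm.contraction
      obtain ⟨y⟩ := hb.contraction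
      obtain ⟨z⟩ := x.comp c
      exact z.comp y
    · obtain ⟨x⟩ := ha.contraction
      obtain ⟨y⟩ := hb.symm.contraction
      obtain ⟨z⟩ := x.comp c
      exact z.comp y)
  le_refl := by
    rintro ⟨T⟩
    exact (IsIso.refl T).contraction
  le_trans := by
    rintro ⟨T⟩ ⟨T'⟩ ⟨T''⟩ ⟨c⟩ ⟨d⟩
    exact c.comp d
  le_antisymm := by
    rintro ⟨T⟩ ⟨T'⟩ ⟨c⟩ ⟨d⟩
    exact Quotient.sound (c.antisymm d)

/-- The codimension of a tree: its number of vertices that are red or blue. -/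
noncomputable def RBWTree.codim {S : Type u} (T : RBWTree S) : ℕ :=
  {v | T.color v = Color.R ∨ T.color v = Color.B}.ncard

namespace RBWContraction

variable {S : Type u} {T T' : RBWTree S}

/-- The codimension of a contraction `T → T'`, as an integer. -/
noncomputable def codim (_c : RBWContraction T T') : ℤ := (T.codim : ℤ) - (T'.codim : ℤ)

/-- A contraction `T → T'` is trivial if it is the identity, up to isomorphism of trees:
no edge is contracted and no color is changed. -/
def IsTrivial (c : RBWContraction T T') : Prop :=
  c.edges = ∅ ∧ ∀ v, T'.color (c.map v) = T.color v

/-- The poset of nontrivial intermediate contractions of `T → T'`: the half-open interval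
`(T, T']` in the poset of RBW-trees. -/
def intermediate (_c : RBWContraction T T') : Set (TreePoset S) :=
  Set.Ioc (TreePoset.mk T) (TreePoset.mk T')

end RBWContraction

/-! ### Regular CW-complexes -/

section CW

open Topology

/-- A CW-complex `C` is regular if the attaching map of each cell of positive dimension is a
homeomorphism onto its image, and this image is a subcomplex.
(In the CW-complexes of Mathlib, the model of an `n`-cell is the unit ball of the maximum norm,
and its attaching map is the restriction of the characteristic map to the unit sphere.) -/
def IsRegular {X : Type} [TopologicalSpace X] (C : Set X) [CWComplex C] : Prop :=
  ∀ n : ℕ, 0 < n → ∀ i : RelCWComplex.cell C n,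
    IsEmbedding ((Metric.sphere (0 : Fin n → ℝ) 1).domRestrict (RelCWComplex.map (C := C) n i)) ∧
    ∃ E : RelCWComplex.Subcomplex C, (E : Set X) = RelCWComplex.cellFrontier (C := C) n i

/-- The cells of all dimensions of a CW-complex. -/
def FacePoset {X : Type} [TopologicalSpace X] (C : Set X) [CWComplex C] : Type :=
  Σ n : ℕ, RelCWComplex.cell C n

/-- The cells of a CW-complex are ordered by inclusion of closed cells. -/
instance {X : Type} [TopologicalSpace X] (C : Set X) [CWComplex C] : Preorder (FacePoset C) :=
  Preorder.lift fun e => RelCWComplex.closedCell (C := C) e.1 e.2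

end CW

end RBW

/-! The contractions of `T` are the faces of a polyhedral cone. Give each red or blue vertex a real
height and each white vertex height 0, and require that heights do not decrease towards the root,
that blue heights are nonnegative and that red heights are nonpositive. A point of this cone defines
a contraction: contract the edges whose ends have equal height and color the result by the sign of
the height. Conversely, any RBW-tree has strictly increasing heights with the signs prescribed by
its colors, and pulling them back along a contraction gives a point of the cone.

A contraction is thus encoded by the set of inequalities that it makes tight, `collapsed`. By
`collapsed_mem_tightSets` and `exists_collapsed_eq` these sets are exactly the tight sets of points
of the cone, and by `nonempty_iff_collapsed` one target contracts to another iff the tight sets are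
included. The latter rests on `Contraction.map_unique`: stability leaves at most one contraction
between two labeled trees. The tree `T` corresponds to the empty tight set, that is, to the whole
cone, of dimension Codim(T), and `T'` to a face of dimension Codim(T')
(`finrank_orthogonal_collapsed`).

So (T, T'] is the set of proper faces that contain a given face, ordered by reverse inclusion.
Duality makes them the nonempty faces of a polytope: take the functionals that are nonnegative on
the cone and vanish on the given face, normalized to be 1 at an interior point of the cone. Its
dimension is Codim(T) - Codim(T') - 1, and a polytope is a ball with its faces as the cells of a
regular CW-complex. -/

/-! ### Faces of bounded polyhedra and their charts. -/

namespace Polyhedron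

open Metric Set

variable {ι : Type*} {E : Type*} [NormedAddCommGroup E] [NormedSpace ℝ E]

/-- The polyhedron cut out by the inequalities `b i ≤ f i x`. -/
def carrier (f : ι → E →L[ℝ] ℝ) (b : ι → ℝ) : Set E := {x | ∀ i, b i ≤ f i x}

/-- The set of inequalities that are equalities at `x`. -/
def active (f : ι → E →L[ℝ] ℝ) (b : ι → ℝ) (x : E) : Set ι := {i | f i x = b i}

/-- The subspace of directions along which the values of `f i`, `i ∈ A`, do not change. -/
def direction (f : ι → E →L[ℝ] ℝ) (A : Set ι) : Submodule ℝ E where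
  carrier := {v | ∀ i ∈ A, f i v = 0}
  zero_mem' := by simp
  add_mem' := by
    intro v w hv hw i hi
    simp [hv i hi, hw i hi]
  smul_mem' := by
    intro c v hv i hi
    simp [hv i hi]

variable {f : ι → E →L[ℝ] ℝ} {b : ι → ℝ}

theorem isClosed_carrier : IsClosed (carrier f b) := by
  have : carrier f b = ⋂ i, {x | b i ≤ f i x} := by ext; simp [carrier]
  rw [this]
  exact isClosed_iInter fun i => isClosed_le continuous_const (f i).continuous

theorem isCompact_carrier [FiniteDimensional ℝ E] (hb : Bornology.IsBounded (carrier f b)) :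
    IsCompact (carrier f b) := by
  have := FiniteDimensional.proper_real E
  exact isCompact_of_isClosed_isBounded isClosed_carrier hb

theorem direction_anti {A B : Set ι} (h : A ⊆ B) : direction f B ≤ direction f A :=
  fun _ hv i hi => hv i (h hi)

theorem sub_mem_direction {A : Set ι} {x y : E} (hx : A ⊆ active f b x) (hy : A ⊆ active f b y) :
    y - x ∈ direction f A := by
  intro i hi
  rw [map_sub, hx hi, hy hi, sub_self]

/-- Strictly larger active sets have strictly smaller face dimension. -/
theorem finrank_direction_lt [FiniteDimensional ℝ E] {x y : E}
    (h : active f b x ⊂ active f b y) :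
    Module.finrank ℝ (direction f (active f b y)) <
      Module.finrank ℝ (direction f (active f b x)) := by
  refine Submodule.finrank_lt_finrank_of_lt ((direction_anti h.1).lt_of_not_ge fun hle => ?_)
  obtain ⟨i, hi, hix⟩ := Set.exists_of_ssubset h
  have := hle (sub_mem_direction (x := x) (y := y) subset_rfl h.1) i hi
  rw [map_sub, sub_eq_zero, show f i y = b i from hi] at this
  exact hix this.symm

/-- A face of a bounded polyhedron is parametrized by a ball of its dimension. -/
theorem exists_face_chart [Finite ι] [FiniteDimensional ℝ E]
    (hb : Bornology.IsBounded (carrier f b)) {x : E} (hx : x ∈ carrier f b)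
    (G : Type*) [NormedAddCommGroup G] [NormedSpace ℝ G] [FiniteDimensional ℝ G]
    (hG : Module.finrank ℝ G = Module.finrank ℝ (direction f (active f b x))) :
    ∃ (ψ : G → E) (χ : E → G), Continuous ψ ∧ Continuous χ ∧ Function.LeftInverse χ ψ ∧
      ψ '' ball 0 1 = {y | y ∈ carrier f b ∧ active f b y = active f b x} ∧
      ψ '' closedBall 0 1 = {y | y ∈ carrier f b ∧ active f b x ⊆ active f b y} ∧
      ψ '' sphere 0 1 = {y | y ∈ carrier f b ∧ active f b x ⊂ active f b y} := by
  set L : G ≃ₗ[ℝ] direction f (active f b x) := LinearEquiv.ofFinrankEq _ _ hG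
  set J : G →ₗ[ℝ] E := (direction f (active f b x)).subtype ∘ₗ L.toLinearMap with hJ
  have hJinj : Function.Injective J := Subtype.val_injective.comp L.injective
  obtain ⟨P, hP⟩ := J.exists_leftInverse_of_injective (LinearMap.ker_eq_bot.2 hJinj)
  have hPJ : ∀ w, P (J w) = w := fun w => LinearMap.congr_fun hP w
  have hJc : Continuous J := J.continuous_of_finiteDimensional
  have hPc : Continuous P := P.continuous_of_finiteDimensional
  have hJmem : ∀ w, ∀ i ∈ active f b x, f i (J w) = 0 := fun w => (L w).2
  have hJsurj : ∀ v ∈ direction f (active f b x), ∃ w, J w = v := by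
    intro v hv
    exact ⟨L.symm ⟨v, hv⟩, by simp [hJ]⟩
  -- In the linear coordinate `w` the face is a compact convex set with the origin in its interior.
  -- A homeomorphism of `G` carries such a set to the unit ball, its interior to the open ball.
  set K : Set G := {w | x + J w ∈ carrier f b} with hK
  have hKmem : ∀ w, w ∈ K ↔ ∀ i, b i ≤ f i x + f i (J w) := by
    intro w; simp [hK, carrier]
  have hKclosed : IsClosed K := isClosed_carrier.preimage (by fun_prop)
  have hKconv : Convex ℝ K := by
    intro u hu w hw s t hs ht hst
    rw [hKmem] at hu hw ⊢
    intro i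
    have h1 := mul_le_mul_of_nonneg_left (hu i) hs
    have h2 := mul_le_mul_of_nonneg_left (hw i) ht
    obtain rfl : t = 1 - s := by linarith
    simp only [map_add, map_smul, smul_eq_mul]
    linarith
  have hKbdd : Bornology.IsBounded K := by
    refine ((isCompact_carrier hb).image (f := fun z => P (z - x)) (by fun_prop)).isBounded.subset
      fun w hw => ⟨x + J w, hw, by simp [hPJ]⟩
  have hact : ∀ w, active f b x ⊆ active f b (x + J w) := by
    intro w i hi
    have : f i x = b i := hi
    simp [active, hJmem w i hi, this]
  have hKint : interior K = {w | w ∈ K ∧ active f b (x + J w) = active f b x} := by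
    ext w
    constructor
    · intro hw
      refine ⟨interior_subset hw, (hact w).antisymm' fun i hi => ?_⟩
      have hi' : f i x + f i (J w) = b i := by simpa [active] using hi
      by_contra hix
      have hlt : b i < f i x := lt_of_le_of_ne (hx i) fun h => hix h.symm
      -- An inequality that is strict at `x` and tight at `x + J w` fails slightly beyond `w` on the
      -- ray from the origin, so `w` is not interior.
      have hcont : Filter.Tendsto (fun t : ℝ => (1 + t) • w) (nhds 0) (nhds w) := by
        have : Continuous fun t : ℝ => (1 + t) • w := by fun_prop
        simpa using this.tendsto 0
      have hev := hcont.eventually (mem_interior_iff_mem_nhds.1 hw)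
      obtain ⟨ε, hε, hball⟩ := Metric.eventually_nhds_iff.1 hev
      have h2 := hball (y := ε / 2) (by
        rw [Real.dist_eq, sub_zero, abs_of_pos (by positivity)]; linarith)
      have h3 := (hKmem _).1 h2 i
      simp only [map_smul, smul_eq_mul] at h3
      nlinarith
    · rintro ⟨hw, hwact⟩
      have hopen : IsOpen (⋂ i ∈ (active f b x)ᶜ, {u : G | b i < f i x + f i (J u)}) :=
        (Set.toFinite _).isOpen_biInter fun i _ =>
          isOpen_lt continuous_const (continuous_const.add ((f i).continuous.comp hJc))
      refine mem_interior.2 ⟨_, fun u hu => ?_, hopen, ?_⟩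
      · rw [hKmem]
        intro i
        by_cases hi : i ∈ active f b x
        · rw [hJmem u i hi, add_zero]; exact hx i
        · exact le_of_lt (by simpa using mem_iInter₂.1 hu i hi)
      · refine mem_iInter₂.2 fun i hi => lt_of_le_of_ne ((hKmem w).1 hw i) fun h => hi ?_
        rw [← hwact]
        simp [active, h]
  have h0 : (0 : G) ∈ interior K := by
    rw [hKint]
    simpa [hK] using hx
  obtain ⟨h, hh1, hh2, -⟩ :=
    exists_homeomorph_image_interior_closure_frontier_eq_unitBall hKconv ⟨0, h0⟩ hKbdd
  rw [hKclosed.closure_eq] at hh2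
  set ψ : G → E := fun y => x + J (h.symm y) with hψ
  have hψinj : Function.Injective ψ := fun u w huw => by
    simpa [hψ, hJinj.eq_iff] using huw
  have im : ∀ s : Set G, ψ '' (h '' s) = (fun w => x + J w) '' s := by
    intro s
    rw [image_image]
    simp [hψ]
  have i1 : ψ '' ball 0 1 = {y | y ∈ carrier f b ∧ active f b y = active f b x} := by
    rw [← hh1, im, hKint]
    ext y
    constructor
    · rintro ⟨w, ⟨hw, hw'⟩, rfl⟩
      exact ⟨hw, hw'⟩
    · rintro ⟨hy, hy'⟩
      obtain ⟨w, hw⟩ := hJsurj _ (sub_mem_direction subset_rfl hy'.ge)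
      have hxy : x + J w = y := by rw [hw]; abel
      exact ⟨w, ⟨by simpa [hK, hxy] using hy, by rw [hxy, hy']⟩, hxy⟩
  have i2 : ψ '' closedBall 0 1 = {y | y ∈ carrier f b ∧ active f b x ⊆ active f b y} := by
    rw [← hh2, im]
    ext y
    constructor
    · rintro ⟨w, hw, rfl⟩
      exact ⟨hw, hact w⟩
    · rintro ⟨hy, hy'⟩
      obtain ⟨w, hw⟩ := hJsurj _ (sub_mem_direction subset_rfl hy')
      have hxy : x + J w = y := by rw [hw]; abel
      exact ⟨w, by simpa [hK, hxy] using hy, hxy⟩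
  -- The linear left inverse `P` of `J` makes the inverse of the chart continuous on all of `E`.
  refine ⟨ψ, fun z => h (P (z - x)), by fun_prop, by fun_prop, fun y => by simp [hψ, hPJ], i1, i2,
    ?_⟩
  rw [← closedBall_sdiff_ball, image_sdiff hψinj, i1, i2]
  ext y
  simp only [mem_sdiff, mem_ofPred_eq, ssubset_iff_subset_ne]
  tauto

end Polyhedron

/-! ### The CW-structure of a bounded polyhedron. -/

namespace Polyhedron

open Metric Set Topology

set_option maxHeartbeats 800000 in
/-- A bounded polyhedron is a regular CW-complex whose cells are the relative interiors of its
faces, and it is homeomorphic to a ball. The faces are indexed by a poset `P`; the face of `p` is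
the one that has the point `x p` in its relative interior. -/
theorem exists_regular_cwComplex {ι : Type*} [Finite ι] {E : Type} [NormedAddCommGroup E]
    [NormedSpace ℝ E] [FiniteDimensional ℝ E] {f : ι → E →L[ℝ] ℝ} {b : ι → ℝ}
    (hb : Bornology.IsBounded (carrier f b)) {P : Type} [PartialOrder P] [Finite P] (x : P → E)
    (hx : ∀ p, x p ∈ carrier f b)
    (hle : ∀ p q, p ≤ q ↔ active f b (x q) ⊆ active f b (x p))
    (hsurj : ∀ y ∈ carrier f b, ∃ p, active f b y = active f b (x p))
    (m : P) (hm : ∀ p, p ≤ m) (n : ℕ)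
    (hn : Module.finrank ℝ (direction f (active f b (x m))) = n) :
    ∃ (X : Type) (_ : TopologicalSpace X) (_ : T2Space X) (_ : CWComplex (univ : Set X)),
      RBW.IsRegular (univ : Set X) ∧
      Nonempty (RBW.FacePoset (univ : Set X) ≃o P) ∧
      Nonempty (X ≃ₜ closedBall (0 : EuclideanSpace ℝ (Fin n)) 1) := by
  classical
  set d : P → ℕ := fun p => Module.finrank ℝ (direction f (active f b (x p))) with hd
  have hinj : ∀ p q, active f b (x p) = active f b (x q) → p = q := fun p q h =>
    le_antisymm ((hle _ _).2 h.ge) ((hle _ _).2 h.le)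
  choose ψ χ hψ hχ hχψ i1 i2 i3 using fun (k : ℕ) (p : {p // d p = k}) =>
    exists_face_chart hb (hx p) (Fin k → ℝ) (by rw [Module.finrank_fin_fun]; exact p.2.symm)
  let X : Type := carrier f b
  -- The value outside the polyhedron is arbitrary; characteristic maps must be defined on the whole
  -- model space, but only closed balls matter.
  let π : E → X := fun y => if h : y ∈ carrier f b then ⟨y, h⟩ else ⟨x m, hx m⟩
  have hπ : ∀ y (h : y ∈ carrier f b), π y = ⟨y, h⟩ := fun y h => dif_pos h
  have hπv : ∀ y ∈ carrier f b, (π y : E) = y := fun y h => by rw [hπ y h]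
  have hπX : ∀ z : X, π z = z := fun z => hπ z z.2
  have hπc : ContinuousOn π (carrier f b) := by
    rw [continuousOn_iff_continuous_domRestrict]
    convert continuous_id (X := X) using 1
    ext1 z
    exact hπX z
  have img : ∀ k p (s : Set (Fin k → ℝ)) (φ : Set ι → Prop),
      ψ k p '' s = {y | y ∈ carrier f b ∧ φ (active f b y)} →
      (fun y => π (ψ k p y)) '' s = {z : X | φ (active f b z)} := by
    intro k p s φ h
    ext z
    constructor
    · rintro ⟨y, hy, rfl⟩
      obtain ⟨h1, h2⟩ : ψ k p y ∈ {y | y ∈ carrier f b ∧ φ (active f b y)} :=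
        h ▸ mem_image_of_mem _ hy
      simpa [hπv _ h1] using h2
    · intro hz
      obtain ⟨y, hy, hyz⟩ : (z : E) ∈ ψ k p '' s := by rw [h]; exact ⟨z.2, hz⟩
      exact ⟨y, hy, by simp [hyz, hπX]⟩
  have j1 : ∀ k p, (fun y => π (ψ k p y)) '' ball 0 1 =
      {z : X | active f b z = active f b (x p)} :=
    fun k p => img k p _ (fun A => A = active f b (x p)) (i1 k p)
  have j2 : ∀ k p, (fun y => π (ψ k p y)) '' closedBall 0 1 =
      {z : X | active f b (x p) ⊆ active f b z} :=
    fun k p => img k p _ (fun A => active f b (x p) ⊆ A) (i2 k p)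
  have j3 : ∀ k p, (fun y => π (ψ k p y)) '' sphere 0 1 =
      {z : X | active f b (x p) ⊂ active f b z} :=
    fun k p => img k p _ (fun A => active f b (x p) ⊂ A) (i3 k p)
  have hmem : ∀ k p, ∀ y ∈ closedBall 0 1, ψ k p y ∈ carrier f b := by
    intro k p y hy
    have : ψ k p y ∈ ψ k p '' closedBall 0 1 := mem_image_of_mem _ hy
    rw [i2] at this
    exact this.1
  have hcont : ∀ k p, ContinuousOn (fun y => π (ψ k p y)) (closedBall 0 1) := fun k p =>
    hπc.comp (hψ k p).continuousOn (hmem k p)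
  let chart : ∀ k, {p // d p = k} → PartialEquiv (Fin k → ℝ) X := fun k p =>
    { toFun := fun y => π (ψ k p y)
      invFun := fun z => χ k p z
      source := ball 0 1
      target := {z : X | active f b z = active f b (x p)}
      map_source' := fun y hy => by rw [← j1 k p]; exact mem_image_of_mem _ hy
      map_target' := fun z hz => by
        rw [← j1 k p] at hz
        obtain ⟨y, hy, rfl⟩ := hz
        simp only
        rw [hπv _ (hmem k p _ (ball_subset_closedBall hy)), hχψ]
        exact hy
      left_inv' := fun y hy => by
        rw [hπv _ (hmem k p _ (ball_subset_closedBall hy)), hχψ]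
      right_inv' := fun z hz => by
        rw [← j1 k p] at hz
        obtain ⟨y, hy, rfl⟩ := hz
        simp only
        rw [hπv _ (hmem k p _ (ball_subset_closedBall hy)), hχψ] }
  let cw : CWComplex (univ : Set X) :=
    { cell := fun k => {p // d p = k}
      map := chart
      source_eq := fun k p => rfl
      continuousOn := hcont
      continuousOn_symm := fun k p => ((hχ k p).comp continuous_subtype_val).continuousOn
      pairwiseDisjoint' := by
        rintro ⟨k, p⟩ - ⟨l, q⟩ - hne
        refine Set.disjoint_left.2 fun z hz hz' => hne ?_
        have h1 : active f b z = active f b (x p) := (j1 k p).le hz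
        have h2 : active f b z = active f b (x q) := (j1 l q).le hz'
        have h3 := hinj _ _ (h1.symm.trans h2)
        obtain ⟨p, rfl⟩ := p
        obtain ⟨q, rfl⟩ := q
        obtain rfl : p = q := h3
        rfl
      mapsTo' := fun k p => by
        -- There are finitely many faces, so all cells of smaller dimension may be listed. A
        -- boundary point has more active inequalities, so its face has smaller dimension.
        refine ⟨fun _ => (Set.toFinite univ).toFinset, fun y hy => ?_⟩
        have hz : π (ψ k p y) ∈ {z : X | active f b (x p) ⊂ active f b z} :=
          (j3 k p).le (mem_image_of_mem _ hy)
        obtain ⟨q, hq⟩ := hsurj _ (π (ψ k p y)).2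
        have hlt : active f b (x p) ⊂ active f b (x q) := by rw [← hq]; exact hz
        have hdlt : d q < k := by
          have := finrank_direction_lt hlt
          rwa [show Module.finrank ℝ (direction f (active f b (x p))) = k from p.2] at this
        simp only [mem_iUnion]
        refine ⟨d q, hdlt, ⟨q, rfl⟩, by simp, (j2 _ ⟨q, rfl⟩).ge ?_⟩
        exact hq.ge
      closed' := fun A _ hA => by
        have : A = ⋃ p : P, A ∩ chart (d p) ⟨p, rfl⟩ '' closedBall 0 1 := by
          ext z
          simp only [mem_iUnion, mem_inter_iff, exists_and_left, iff_self_and]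
          intro _
          obtain ⟨q, hq⟩ := hsurj _ z.2
          exact ⟨q, (j2 _ ⟨q, rfl⟩).ge hq.ge⟩
        rw [this]
        exact isClosed_iUnion_of_finite fun p => hA _ _
      union' := by
        refine eq_univ_of_forall fun z => ?_
        obtain ⟨q, hq⟩ := hsurj _ z.2
        simp only [mem_iUnion]
        exact ⟨d q, ⟨q, rfl⟩, (j2 _ ⟨q, rfl⟩).ge hq.ge⟩ }
  refine ⟨X, inferInstance, inferInstance, cw, fun k _ (p : {p // d p = k}) => ⟨?_, ?_⟩, ⟨?_⟩, ?_⟩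
  · have hmem' : ∀ y : sphere (0 : Fin k → ℝ) 1, ψ k p y ∈ carrier f b := fun y =>
      hmem k p _ (sphere_subset_closedBall y.2)
    -- The continuous left inverse `χ` of the chart makes the attaching map an embedding.
    refine IsEmbedding.of_comp (g := fun z : X => χ k p z)
      (continuousOn_iff_continuous_domRestrict.1 ((hcont k p).mono sphere_subset_closedBall))
      ((hχ k p).comp continuous_subtype_val) ?_
    convert IsEmbedding.subtypeVal (p := (· ∈ sphere (0 : Fin k → ℝ) 1)) using 1
    ext1 y
    change χ k p (π (ψ k p y)) = y
    rw [hπv _ (hmem' y), hχψ]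
  · refine ⟨⟨{z : X | active f b (x p) ⊂ active f b z},
      fun l => ({q | active f b (x p) ⊂ active f b (x q)} : Set {q // d q = l}), ?_, ?_⟩,
      (j3 k p).symm⟩
    · rw [← j3 k p]
      exact ((isCompact_sphere _ _).image_of_continuousOn
        ((hcont k p).mono sphere_subset_closedBall)).isClosed
    · ext z
      simp only [empty_union, mem_iUnion]
      constructor
      · rintro ⟨l, ⟨(q : {q // d q = l}), hq⟩, hz⟩
        have hz' : active f b z = active f b (x q) := (j1 l q).le hz
        change _ ⊂ active f b z
        rw [hz']
        exact hq
      · intro hz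
        obtain ⟨r, hr⟩ := hsurj _ z.2
        have hz' : active f b (x p) ⊂ active f b (x r) := by rw [← hr]; exact hz
        exact ⟨d r, ⟨⟨r, rfl⟩, hz'⟩, (j1 _ ⟨r, rfl⟩).ge hr⟩
  · refine
      { toFun := fun s => s.2.1
        invFun := fun p => ⟨d p, p, rfl⟩
        left_inv := ?_
        right_inv := fun p => rfl
        map_rel_iff' := ?_ }
    · rintro ⟨k, p, rfl⟩
      rfl
    · rintro ⟨k, (p : {p // d p = k})⟩ ⟨l, (q : {p // d p = l})⟩
      have e : LE.le (α := RBW.FacePoset (univ : Set X)) ⟨k, p⟩ ⟨l, q⟩ ↔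
          {z : X | active f b (x p) ⊆ active f b z} ⊆
            {z : X | active f b (x q) ⊆ active f b z} := by
        rw [← j2 k p, ← j2 l q]
        exact Iff.rfl
      rw [e]
      change p.1 ≤ q.1 ↔ _
      rw [hle]
      exact ⟨fun h z hz => h.trans hz, fun h => h (show (⟨x p, hx p⟩ : X) ∈ _ from Subset.refl _)⟩
  -- The closed face of the greatest element `m` is the whole polyhedron, so its chart, now with a
  -- Euclidean model, is the homeomorphism with the ball.
  · obtain ⟨ξ, η, hξ, hη, hηξ, -, k2, -⟩ := exists_face_chart hb (hx m) (EuclideanSpace ℝ (Fin n))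
      (by rw [finrank_euclideanSpace_fin, hn])
    have hmin : ∀ y ∈ carrier f b, active f b (x m) ⊆ active f b y := by
      intro y hy
      obtain ⟨p, hp⟩ := hsurj y hy
      rw [hp]
      exact (hle _ _).1 (hm p)
    have k3 : ξ '' closedBall 0 1 = carrier f b := by
      rw [k2]
      ext y
      exact ⟨fun h => h.1, fun h => ⟨h, hmin y h⟩⟩
    have k4 : ∀ z : X, η z ∈ closedBall 0 1 ∧ ξ (η z) = z := by
      intro z
      obtain ⟨y, hy, hyz⟩ : (z : E) ∈ ξ '' closedBall 0 1 := by rw [k3]; exact z.2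
      rw [← hyz, hηξ]
      exact ⟨hy, rfl⟩
    exact ⟨{
      toFun := fun z => ⟨η z, (k4 z).1⟩
      invFun := fun y => ⟨ξ y, by rw [← k3]; exact mem_image_of_mem _ y.2⟩
      left_inv := fun z => Subtype.ext (k4 z).2
      right_inv := fun y => Subtype.ext (hηξ y)
      continuous_toFun := (hη.comp continuous_subtype_val).subtype_mk _
      continuous_invFun := (hξ.comp continuous_subtype_val).subtype_mk
        fun y => k3.le (mem_image_of_mem _ y.2) }⟩

end Polyhedron

/-! ### Polyhedral cones and slices of faces of the dual cone. -/

namespace PolyhedralCone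

open Set
open scoped InnerProductSpace

variable {κ : Type*} {E : Type*} [NormedAddCommGroup E] [InnerProductSpace ℝ E]

/-- The cone cut out by the inequalities `0 ≤ ⟪g e, h⟫`. -/
def cone (g : κ → E) : Set E := {h | ∀ e, 0 ≤ ⟪g e, h⟫_ℝ}

/-- The set of inequalities that are equalities at `h`. -/
def tight (g : κ → E) (h : E) : Set κ := {e | ⟪g e, h⟫_ℝ = 0}

/-- The sets of the form `tight g h` for points `h` of the cone. They correspond to its faces. -/
def tightSets (g : κ → E) : Set (Set κ) := tight g '' cone g

variable {g : κ → E}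

theorem zero_mem_cone : (0 : E) ∈ cone g := fun e => by simp

theorem add_mem_cone {h k : E} (hh : h ∈ cone g) (hk : k ∈ cone g) : h + k ∈ cone g := fun e => by
  rw [inner_add_right]
  exact add_nonneg (hh e) (hk e)

theorem tight_add {h k : E} (hh : h ∈ cone g) (hk : k ∈ cone g) :
    tight g (h + k) = tight g h ∩ tight g k := by
  ext e
  simp only [tight, mem_ofPred_eq, mem_inter_iff, inner_add_right]
  exact add_eq_zero_iff_of_nonneg (hh e) (hk e)

theorem mem_orthogonal_span_image {τ : Set κ} {h : E} :
    h ∈ (Submodule.span ℝ (g '' τ))ᗮ ↔ τ ⊆ tight g h := by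
  rw [Submodule.mem_orthogonal]
  constructor
  · exact fun h1 e he => h1 _ (Submodule.subset_span (mem_image_of_mem _ he))
  · intro h1 u hu
    induction hu using Submodule.span_induction with
    | mem u hu => obtain ⟨e, he, rfl⟩ := hu; exact h1 he
    | zero => simp
    | add u v _ _ h2 h3 => rw [inner_add_left, h2, h3, add_zero]
    | smul c u _ h2 => rw [inner_smul_left, h2, mul_zero]

/-- Inequalities tight at `h` stay tight along `k`, and the finitely many strict ones survive a
small step. Here `k` need not lie in the cone. -/
theorem exists_sub_smul_mem_cone [Finite κ] {h k : E} (hh : h ∈ cone g)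
    (hk : tight g h ⊆ tight g k) : ∃ ε : ℝ, 0 < ε ∧ h - ε • k ∈ cone g := by
  have hev : ∀ᶠ t : ℝ in nhdsWithin 0 (Ioi 0), ∀ e, 0 ≤ ⟪g e, h - t • k⟫_ℝ := by
    refine Filter.eventually_all.2 fun e => ?_
    by_cases he : e ∈ tight g h
    · refine Filter.Eventually.of_forall fun t => ?_
      have h1 : ⟪g e, h⟫_ℝ = 0 := he
      have h2 : ⟪g e, k⟫_ℝ = 0 := hk he
      simp [inner_sub_right, inner_smul_right, h1, h2]
    · have hpos : 0 < ⟪g e, h⟫_ℝ := lt_of_le_of_ne (hh e) fun h => he h.symm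
      have hc : Continuous fun t : ℝ => ⟪g e, h - t • k⟫_ℝ := by fun_prop
      have := (hc.tendsto 0).eventually (lt_mem_nhds (a := 0) (by simpa using hpos))
      exact (this.filter_mono nhdsWithin_le_nhds).mono fun t ht => ht.le
  obtain ⟨t, ht, ht0⟩ := (hev.and self_mem_nhdsWithin).exists
  exact ⟨t, ht0, ht⟩

/-- The cone is generated by any choice of one point in the relative interior of each face. -/
theorem inner_nonneg_of_forall_tightSets [Finite κ] (hg : ∀ h, tight g h = univ → h = 0)
    {H : Set κ → E} (hH : ∀ σ ∈ tightSets g, H σ ∈ cone g ∧ tight g (H σ) = σ) {φ : E} {h : E}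
    (hh : h ∈ cone g) (hφ : ∀ σ ∈ tightSets g, tight g h ⊆ σ → 0 ≤ ⟪H σ, φ⟫_ℝ) :
    0 ≤ ⟪h, φ⟫_ℝ := by
  induction hn : (tight g h)ᶜ.ncard using Nat.strong_induction_on generalizing h with
  | _ n ih =>
  obtain ⟨hk, hkt⟩ := hH _ (mem_image_of_mem _ hh)
  have hk0 := hφ _ (mem_image_of_mem _ hh) subset_rfl
  set k := H (tight g h)
  rcases (tight g h)ᶜ.eq_empty_or_nonempty with hemp | hne
  · rw [hg h (compl_empty_iff.1 hemp), inner_zero_left]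
  · have hpos : ∀ e ∈ (tight g h)ᶜ, 0 < ⟪g e, h⟫_ℝ ∧ 0 < ⟪g e, k⟫_ℝ := by
      intro e he
      refine ⟨lt_of_le_of_ne (hh e) fun h => he h.symm, lt_of_le_of_ne (hk e) fun h => he ?_⟩
      rw [← hkt]
      exact h.symm
    -- The least ratio is the largest `t` for which `h - t • k` stays in the cone. There the
    -- inequality `a` becomes tight as well, so the induction on the number of strict inequalities
    -- applies.
    obtain ⟨a, ha, hmin⟩ := exists_min_image _ (fun e => ⟪g e, h⟫_ℝ / ⟪g e, k⟫_ℝ)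
      (Set.toFinite (tight g h)ᶜ) hne
    set t := ⟪g a, h⟫_ℝ / ⟪g a, k⟫_ℝ with ht
    have ht0 : 0 ≤ t := div_nonneg (hh a) (hk a)
    have hle : ∀ e, 0 ≤ ⟪g e, h - t • k⟫_ℝ := by
      intro e
      rw [inner_sub_right, inner_smul_right]
      by_cases he : e ∈ tight g h
      · have h1 : ⟪g e, h⟫_ℝ = 0 := he
        have h2 : ⟪g e, k⟫_ℝ = 0 := by rw [← hkt] at he; exact he
        simp [h1, h2]
      · have := hmin e he
        rw [le_div_iff₀ (hpos e he).2] at this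
        linarith
    have hsub : tight g h ⊆ tight g (h - t • k) := by
      intro e he
      have h1 : ⟪g e, h⟫_ℝ = 0 := he
      have h2 : ⟪g e, k⟫_ℝ = 0 := by rw [← hkt] at he; exact he
      simp [tight, inner_sub_right, inner_smul_right, h1, h2]
    have hat : a ∈ tight g (h - t • k) := by
      have := (hpos a ha).2.ne'
      simp only [tight, mem_ofPred_eq, inner_sub_right, inner_smul_right, ht]
      field_simp
      ring
    have hlt : (tight g (h - t • k))ᶜ.ncard < n := by
      rw [← hn]
      exact ncard_lt_ncard (ssubset_iff_exists.2 ⟨compl_subset_compl.2 hsub, a, ha, fun h => h hat⟩)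
    have h3 := ih _ hlt hle (fun σ hσ hs => hφ σ hσ (hsub.trans hs)) rfl
    rw [inner_sub_left, inner_smul_left] at h3
    have := mul_nonneg ht0 hk0
    simp only [conj_trivial] at h3
    linarith

theorem inner_eq_zero_of_tight_subset [Finite κ] {φ : E} (hφ : ∀ h ∈ cone g, 0 ≤ ⟪h, φ⟫_ℝ)
    {h k : E} (hh : h ∈ cone g) (hk : k ∈ cone g) (h0 : ⟪h, φ⟫_ℝ = 0)
    (hs : tight g h ⊆ tight g k) : ⟪k, φ⟫_ℝ = 0 := by
  obtain ⟨ε, hε, hm⟩ := exists_sub_smul_mem_cone hh hs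
  have h1 := hφ _ hm
  rw [inner_sub_left, inner_smul_left, h0, conj_trivial] at h1
  have h2 := hφ _ hk
  nlinarith

/-- The zero set on the cone of a functional that is nonnegative there is a face. -/
theorem exists_inner_eq_zero_iff [Finite κ] {φ : E} (hφ : ∀ h ∈ cone g, 0 ≤ ⟪h, φ⟫_ℝ) :
    ∃ τ ∈ tightSets g, ∀ h ∈ cone g, ⟪h, φ⟫_ℝ = 0 ↔ τ ⊆ tight g h := by
  -- A zero of `φ` with the fewest tight inequalities lies in the relative interior of the face:
  -- adding another zero intersects the tight sets, which by minimality changes nothing.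
  obtain ⟨τ, hτ, hmin⟩ := exists_min_image {σ | ∃ h ∈ cone g, ⟪h, φ⟫_ℝ = 0 ∧ tight g h = σ}
    Set.ncard (Set.toFinite _) ⟨_, 0, zero_mem_cone, inner_zero_left _, rfl⟩
  obtain ⟨k, hk, hk0, rfl⟩ := hτ
  refine ⟨_, mem_image_of_mem _ hk, fun h hh => ⟨fun h0 => ?_, fun hs =>
    inner_eq_zero_of_tight_subset hφ hk hh hk0 hs⟩⟩
  have h1 := hmin _ ⟨_, add_mem_cone hk hh, by rw [inner_add_left, hk0, h0, add_zero], rfl⟩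
  rw [tight_add hk hh] at h1
  exact inter_eq_left.1 (eq_of_subset_of_ncard_le inter_subset_left h1)

/-- The sum of the `g e` with `e ∈ τ` works, since a sum of nonnegative terms vanishes iff each term
does. It lies in the relative interior of the dual face. -/
theorem exists_functional [Finite κ] (g : κ → E) (τ : Set κ) :
    ∃ φ : E, ∀ h ∈ cone g, 0 ≤ ⟪h, φ⟫_ℝ ∧ (⟪h, φ⟫_ℝ = 0 ↔ τ ⊆ tight g h) := by
  refine ⟨∑ e ∈ (Set.toFinite τ).toFinset, g e, fun h hh => ?_⟩
  rw [inner_sum]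
  have hnn : ∀ e ∈ (Set.toFinite τ).toFinset, 0 ≤ ⟪h, g e⟫_ℝ := fun e _ => by
    rw [real_inner_comm]; exact hh e
  refine ⟨Finset.sum_nonneg hnn, ?_⟩
  rw [Finset.sum_eq_zero_iff_of_nonneg hnn]
  simp [subset_def, tight, real_inner_comm]

/-- A ball around the interior point `h` lies in the cone, and evaluating `φ` at a point of it
displaced from `h` against `φ` bounds the norm. Hence the slice of the dual cone is bounded. -/
theorem exists_norm_bound [Finite κ] {h : E} (hh : h ∈ cone g) (h0 : tight g h = ∅) :
    ∃ C : ℝ, ∀ φ : E, (∀ k ∈ cone g, 0 ≤ ⟪k, φ⟫_ℝ) → ⟪h, φ⟫_ℝ = 1 → ‖φ‖ ≤ C := by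
  have hev : ∀ᶠ k in nhds h, ∀ e, 0 ≤ ⟪g e, k⟫_ℝ := by
    refine Filter.eventually_all.2 fun e => ?_
    have hpos : 0 < ⟪g e, h⟫_ℝ := lt_of_le_of_ne (hh e) fun h' =>
      (h0 ▸ notMem_empty e : e ∉ tight g h) h'.symm
    have hc : Continuous fun k : E => ⟪g e, k⟫_ℝ := by fun_prop
    exact ((hc.tendsto h).eventually (lt_mem_nhds hpos)).mono fun k hk => hk.le
  obtain ⟨ε, hε, hball⟩ := Metric.eventually_nhds_iff.1 hev
  refine ⟨2 / ε, fun φ hφ h1 => ?_⟩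
  rcases eq_or_ne φ 0 with rfl | hne
  · simp at h1
  have hn : 0 < ‖φ‖ := norm_pos_iff.2 hne
  have h2 := hφ (h - (ε / (2 * ‖φ‖)) • φ) (hball (by
    rw [dist_eq_norm, sub_sub_cancel_left, norm_neg, norm_smul, Real.norm_of_nonneg (by positivity)]
    field_simp
    linarith))
  rw [inner_sub_left, inner_smul_left, h1, conj_trivial, real_inner_self_eq_norm_sq] at h2
  field_simp at h2 ⊢
  linarith

/-- The nonempty tight sets contained in a given one, that is, the proper faces containing
a given face, are the faces of a polytope, a slice of a face of the dual cone. -/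
theorem exists_regular_cwComplex {κ : Type} [Finite κ] {E : Type} [NormedAddCommGroup E]
    [InnerProductSpace ℝ E] [FiniteDimensional ℝ E] {g : κ → E}
    (hg : ∀ h, tight g h = univ → h = 0) (h0 : ∅ ∈ tightSets g) {τ₀ : Set κ}
    (hτ₀ : τ₀ ∈ tightSets g) (hne : τ₀.Nonempty) (n : ℕ)
    (hn : Module.finrank ℝ (Submodule.span ℝ (g '' τ₀))ᗮ + (n + 1) = Module.finrank ℝ E) :
    ∃ (X : Type) (_ : TopologicalSpace X) (_ : T2Space X)
      (_ : Topology.CWComplex (univ : Set X)),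
      RBW.IsRegular (univ : Set X) ∧
      Nonempty (RBW.FacePoset (univ : Set X) ≃o
        {σ : Set κ // σ ∈ tightSets g ∧ σ.Nonempty ∧ σ ⊆ τ₀}) ∧
      Nonempty (X ≃ₜ Metric.closedBall (0 : EuclideanSpace ℝ (Fin n)) 1) := by
  classical
  have hrep : ∀ σ ∈ tightSets g, ∃ h, h ∈ cone g ∧ tight g h = σ := fun σ hσ => by
    obtain ⟨h, hh, rfl⟩ := hσ
    exact ⟨h, hh, rfl⟩
  choose! H hH using hrep
  have hpos : ∀ φ, (∀ σ ∈ tightSets g, 0 ≤ ⟪H σ, φ⟫_ℝ) → ∀ h ∈ cone g, 0 ≤ ⟪h, φ⟫_ℝ :=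
    fun φ hφ h hh => inner_nonneg_of_forall_tightSets hg hH hh fun σ hσ _ => hφ σ hσ
  -- The index `true` gives nonnegativity at `H σ`, or value at least 1 if `σ` is empty. The index
  -- `false` gives the reverse inequality where an equality is wanted, at the empty set and at the
  -- `σ` containing `τ₀`, and the vacuous `0 ≤ 0` elsewhere.
  let f : tightSets g × Bool → E →L[ℝ] ℝ := fun i =>
    if i.2 then innerSL ℝ (H i.1) else if (i.1 : Set κ) = ∅ ∨ τ₀ ⊆ i.1 then -innerSL ℝ (H i.1)
      else 0
  let b : tightSets g × Bool → ℝ := fun i =>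
    if (i.1 : Set κ) = ∅ then (if i.2 then 1 else -1) else 0
  have hτ₀e : ¬ τ₀ ⊆ ∅ := fun h => hne.ne_empty (subset_empty_iff.1 h)
  have hcar : ∀ φ, φ ∈ Polyhedron.carrier f b ↔ (∀ h ∈ cone g, 0 ≤ ⟪h, φ⟫_ℝ) ∧
      ⟪H ∅, φ⟫_ℝ = 1 ∧ ∀ σ ∈ tightSets g, τ₀ ⊆ σ → ⟪H σ, φ⟫_ℝ = 0 := by
    intro φ
    constructor
    · intro h
      have h1 : ∀ σ ∈ tightSets g, 0 ≤ ⟪H σ, φ⟫_ℝ := by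
        intro σ hσ
        have := h (⟨σ, hσ⟩, true)
        simp only [f, b, if_true, innerSL_apply_apply] at this
        split_ifs at this
        · linarith
        · exact this
      refine ⟨hpos φ h1, ?_, fun σ hσ hs => ?_⟩
      · have h2 := h (⟨∅, h0⟩, true)
        have h3 := h (⟨∅, h0⟩, false)
        simp [f, b] at h2 h3
        linarith
      · have h3 := h (⟨σ, hσ⟩, false)
        have hσe : σ ≠ ∅ := by rintro rfl; exact hτ₀e hs
        simp [f, b, hσe, hs] at h3
        linarith [h1 σ hσ]
    · rintro ⟨h1, h2, h3⟩ ⟨⟨σ, hσ⟩, _ | _⟩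
      · by_cases hσe : σ = ∅
        · subst hσe
          simp [f, b, h2]
        · by_cases hs : τ₀ ⊆ σ
          · simp [f, b, hσe, hs, h3 σ hσ hs]
          · simp [f, b, hσe, hs]
      · by_cases hσe : σ = ∅
        · subst hσe
          simp [f, b, h2]
        · simpa [f, b, hσe] using h1 _ (hH σ hσ).1
  have hact : ∀ φ ∈ Polyhedron.carrier f b, ∀ (σ : tightSets g) (c : Bool),
      (σ, c) ∈ Polyhedron.active f b φ ↔
        (c = false ∨ (σ : Set κ) = ∅ ∨ ⟪H σ, φ⟫_ℝ = 0) := by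
    intro φ hφ σ c
    obtain ⟨h1, h2, h3⟩ := (hcar φ).1 hφ
    obtain ⟨σ, hσ⟩ := σ
    by_cases hσe : σ = ∅
    · subst hσe
      cases c <;> simp [f, b, Polyhedron.active, h2]
    · cases c
      · by_cases hs : τ₀ ⊆ σ
        · simp [f, b, Polyhedron.active, hσe, hs, h3 σ hσ hs]
        · simp [f, b, Polyhedron.active, hσe, hs]
      · simp [f, b, Polyhedron.active, hσe]
  have hactle : ∀ φ ∈ Polyhedron.carrier f b, ∀ ψ ∈ Polyhedron.carrier f b,
      Polyhedron.active f b φ ⊆ Polyhedron.active f b ψ ↔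
        ∀ σ ∈ tightSets g, ⟪H σ, φ⟫_ℝ = 0 → ⟪H σ, ψ⟫_ℝ = 0 := by
    intro φ hφ ψ hψ
    constructor
    · intro h σ hσ h4
      have h5 := (hact ψ hψ ⟨σ, hσ⟩ true).1 (h ((hact φ hφ ⟨σ, hσ⟩ true).2 (Or.inr (Or.inr h4))))
      simp only [Bool.true_eq_false, false_or] at h5
      refine h5.resolve_left ?_
      rintro rfl
      rw [((hcar φ).1 hφ).2.1] at h4
      exact one_ne_zero h4
    · rintro h ⟨σ, c⟩ hi
      rw [hact φ hφ] at hi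
      rw [hact ψ hψ]
      exact hi.imp_right fun h' => h'.imp_right (h σ σ.2)
  have hx : ∀ p : {σ : Set κ // σ ∈ tightSets g ∧ σ.Nonempty ∧ σ ⊆ τ₀},
      ∃ φ ∈ Polyhedron.carrier f b, ∀ σ ∈ tightSets g, ⟪H σ, φ⟫_ℝ = 0 ↔ p.1 ⊆ σ := by
    rintro ⟨τ, hτ, hτne, hτs⟩
    obtain ⟨φ, hφ⟩ := exists_functional g τ
    have h1 : 0 < ⟪H ∅, φ⟫_ℝ := by
      refine lt_of_le_of_ne (hφ _ (hH ∅ h0).1).1 fun h => hτne.ne_empty ?_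
      have := (hφ _ (hH ∅ h0).1).2.1 h.symm
      rw [(hH ∅ h0).2] at this
      exact subset_empty_iff.1 this
    have hz : ∀ σ ∈ tightSets g, ⟪H σ, (⟪H ∅, φ⟫_ℝ)⁻¹ • φ⟫_ℝ = 0 ↔ τ ⊆ σ := by
      intro σ hσ
      rw [inner_smul_right, mul_eq_zero, or_iff_right (inv_pos.2 h1).ne', (hφ _ (hH σ hσ).1).2,
        (hH σ hσ).2]
    refine ⟨(⟪H ∅, φ⟫_ℝ)⁻¹ • φ, (hcar _).2 ⟨fun h hh => ?_, ?_, fun σ hσ hs =>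
      (hz σ hσ).2 (hτs.trans hs)⟩, hz⟩
    · rw [inner_smul_right]
      exact mul_nonneg (inv_pos.2 h1).le (hφ h hh).1
    · rw [inner_smul_right, inv_mul_cancel₀ h1.ne']
  choose x hxc hxz using hx
  refine Polyhedron.exists_regular_cwComplex (f := f) (b := b) ?_ x hxc (fun p q => ?_)
    (fun φ hφ => ?_) ⟨τ₀, hτ₀, hne, subset_rfl⟩ (fun p => p.2.2.2) n ?_
  · obtain ⟨C, hC⟩ := exists_norm_bound (hH ∅ h0).1 (hH ∅ h0).2
    refine Metric.isBounded_closedBall (x := (0 : E)) (r := C) |>.subset fun φ hφ => ?_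
    rw [mem_closedBall_zero_iff]
    exact hC φ ((hcar φ).1 hφ).1 ((hcar φ).1 hφ).2.1
  · rw [hactle _ (hxc q) _ (hxc p)]
    constructor
    · intro hpq σ hσ
      rw [hxz q σ hσ, hxz p σ hσ]
      exact fun h => (show p.1 ⊆ q.1 from hpq).trans h
    · intro h
      exact (hxz p _ q.2.1).1 (h _ q.2.1 ((hxz q _ q.2.1).2 subset_rfl))
  · obtain ⟨h1, h2, h3⟩ := (hcar φ).1 hφ
    obtain ⟨τ, hτ, hτz⟩ := exists_inner_eq_zero_iff h1
    have hz : ∀ σ ∈ tightSets g, ⟪H σ, φ⟫_ℝ = 0 ↔ τ ⊆ σ := fun σ hσ => by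
      rw [hτz _ (hH σ hσ).1, (hH σ hσ).2]
    have hτne : τ.Nonempty := by
      rw [nonempty_iff_ne_empty]
      rintro rfl
      rw [(hz ∅ h0).2 subset_rfl] at h2
      exact zero_ne_one h2
    refine ⟨⟨τ, hτ, hτne, (hz τ₀ hτ₀).1 (h3 τ₀ hτ₀ subset_rfl)⟩, subset_antisymm ?_ ?_⟩
    · rw [hactle _ hφ _ (hxc _)]
      intro σ hσ h
      rw [hxz _ σ hσ]
      exact (hz σ hσ).1 h
    · rw [hactle _ (hxc _) _ hφ]
      intro σ hσ h
      rw [hxz _ σ hσ] at h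
      exact (hz σ hσ).2 h
  · set m : {σ : Set κ // σ ∈ tightSets g ∧ σ.Nonempty ∧ σ ⊆ τ₀} := ⟨τ₀, hτ₀, hne, subset_rfl⟩
    -- `L` is the linear span of the face of `τ₀`. The polytope has the directions orthogonal to `L`
    -- and to `H ∅`, which is not in `L`; the normalization therefore costs one more dimension.
    set L := (Submodule.span ℝ (g '' τ₀))ᗮ with hL
    have memL : ∀ h, h ∈ L ↔ τ₀ ⊆ tight g h := fun h => mem_orthogonal_span_image
    have hdir : Polyhedron.direction f (Polyhedron.active f b (x m)) =
        (L ⊔ Submodule.span ℝ {H ∅})ᗮ := by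
      ext v
      rw [← Submodule.inf_orthogonal, Submodule.mem_inf,
        Submodule.mem_orthogonal_singleton_iff_inner_right]
      have e1 : v ∈ Polyhedron.direction f (Polyhedron.active f b (x m)) ↔
          ⟪H ∅, v⟫_ℝ = 0 ∧ ∀ σ ∈ tightSets g, τ₀ ⊆ σ → ⟪H σ, v⟫_ℝ = 0 := by
        constructor
        · intro h
          refine ⟨?_, fun σ hσ hs => ?_⟩
          · simpa [f] using h (⟨∅, h0⟩, true) ((hact _ (hxc m) _ _).2 (by simp))
          · simpa [f] using h (⟨σ, hσ⟩, true)
              ((hact _ (hxc m) _ _).2 (Or.inr (Or.inr ((hxz m σ hσ).2 hs))))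
        · rintro ⟨h1, h2⟩ ⟨⟨σ, hσ⟩, c⟩ hi
          by_cases hσe : σ = ∅
          · subst hσe
            cases c <;> simp [f, h1]
          · by_cases hs : τ₀ ⊆ σ
            · cases c <;> simp [f, hσe, hs, h2 σ hσ hs]
            · cases c
              · simp [f, hσe, hs]
              · rw [hact _ (hxc m), hxz m σ hσ] at hi
                simp [hσe] at hi
                exact absurd hi hs
      rw [e1, and_comm]
      refine and_congr_left fun _ => ?_
      rw [Submodule.mem_orthogonal]
      constructor
      · intro h1 l hl
        rw [memL] at hl
        -- For `l` in `L` and small `ε > 0`, the point `H τ₀ - ε • l` still lies in the face of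
        -- `τ₀`, where `w` is nonnegative because it vanishes at the chosen generators. The same for
        -- `-w` gives equality.
        have key : ∀ w : E, (∀ σ ∈ tightSets g, τ₀ ⊆ σ → ⟪H σ, w⟫_ℝ = 0) →
            ⟪l, w⟫_ℝ ≤ 0 := by
          intro w hw
          have hlt : tight g (H τ₀) ⊆ tight g l := by rw [(hH τ₀ hτ₀).2]; exact hl
          obtain ⟨ε, hε, hm⟩ := exists_sub_smul_mem_cone (hH τ₀ hτ₀).1 hlt
          have h2 := inner_nonneg_of_forall_tightSets hg hH (φ := w) hm fun σ hσ hs => by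
            refine (hw σ hσ (subset_trans (fun e he => hs ?_) subset_rfl)).ge
            have h3 : ⟪g e, l⟫_ℝ = 0 := hl he
            have h4 : ⟪g e, H τ₀⟫_ℝ = 0 := by
              have : e ∈ tight g (H τ₀) := by rw [(hH τ₀ hτ₀).2]; exact he
              exact this
            simp [tight, inner_sub_right, inner_smul_right, h3, h4]
          rw [inner_sub_left, inner_smul_left, hw τ₀ hτ₀ subset_rfl, conj_trivial] at h2
          nlinarith
        have k1 := key v h1
        have k2 := key (-v) fun σ hσ hs => by rw [inner_neg_right, h1 σ hσ hs, neg_zero]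
        rw [inner_neg_right] at k2
        linarith
      · intro h1 σ hσ hs
        exact h1 _ ((memL _).2 (by rw [(hH σ hσ).2]; exact hs))
    have hnot : H ∅ ∉ L := by
      rw [memL, (hH ∅ h0).2]
      exact hτ₀e
    have hdisj : L ⊓ Submodule.span ℝ {H ∅} = ⊥ :=
      disjoint_iff.1 ((Submodule.disjoint_span_singleton' (by
        rintro h; exact hnot (h ▸ L.zero_mem))).2 hnot)
    have hd1 := Submodule.finrank_sup_add_finrank_inf_eq L (Submodule.span ℝ {H ∅})
    rw [hdisj, finrank_bot, finrank_span_singleton (by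
        rintro h; exact hnot (h ▸ L.zero_mem))] at hd1
    have hd2 := Submodule.finrank_add_finrank_orthogonal (L ⊔ Submodule.span ℝ {H ∅})
    rw [hdir]
    omega

end PolyhedralCone

/-! ### Rooted trees through their parent function. -/

namespace RBW

namespace LabeledTree

universe u

variable {S : Type u}

instance (T : LabeledTree S) : Finite T.V := T.finite_V

/-- The path from a vertex to the root. -/
noncomputable def pathToRoot (T : LabeledTree S) (v : T.V) : T.graph.Walk v T.root :=
  (T.isTree.existsUnique_path v T.root).choose

/-- The second vertex on the path from `v` to the root, and the root if `v` is the root. -/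
noncomputable def parent (T : LabeledTree S) (v : T.V) : T.V := (T.pathToRoot v).snd

/-- The distance from a vertex to the root. -/
noncomputable def depth (T : LabeledTree S) (v : T.V) : ℕ := (T.pathToRoot v).length

variable (T : LabeledTree S)

theorem isPath_pathToRoot (v : T.V) : (T.pathToRoot v).IsPath :=
  (T.isTree.existsUnique_path v T.root).choose_spec.1

theorem eq_pathToRoot {v : T.V} {p : T.graph.Walk v T.root} (hp : p.IsPath) :
    p = T.pathToRoot v :=
  (T.isTree.existsUnique_path v T.root).unique hp (T.isPath_pathToRoot v)

theorem pathToRoot_cons {v w : T.V} {h : T.graph.Adj v w} {p : T.graph.Walk w T.root}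
    (hp : (SimpleGraph.Walk.cons h p).IsPath) :
    T.parent v = w ∧ T.pathToRoot w = p ∧ T.depth v = T.depth w + 1 := by
  have h1 := T.eq_pathToRoot hp
  have h2 := T.eq_pathToRoot hp.of_cons
  refine ⟨?_, h2.symm, ?_⟩
  · rw [parent, ← h1]; simp
  · rw [depth, depth, ← h1, ← h2]; simp

theorem parent_root : T.parent T.root = T.root := by
  rw [parent, ← T.eq_pathToRoot (p := SimpleGraph.Walk.nil) SimpleGraph.Walk.IsPath.nil]
  rfl

theorem exists_pathToRoot_eq_cons {v : T.V} (hv : v ≠ T.root) :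
    ∃ h : T.graph.Adj v (T.parent v), T.pathToRoot v = .cons h (T.pathToRoot (T.parent v)) := by
  have hp := T.isPath_pathToRoot v
  generalize hq : T.pathToRoot v = q at hp
  cases q with
  | nil => exact absurd rfl hv
  | cons h p =>
    obtain ⟨h1, h2, -⟩ := T.pathToRoot_cons hp
    subst h1
    exact ⟨h, by rw [h2]⟩

theorem adj_parent {v : T.V} (hv : v ≠ T.root) : T.graph.Adj v (T.parent v) :=
  (T.exists_pathToRoot_eq_cons hv).1

theorem parent_ne {v : T.V} (hv : v ≠ T.root) : T.parent v ≠ v := (T.adj_parent hv).ne'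

theorem depth_eq {v : T.V} (hv : v ≠ T.root) : T.depth v = T.depth (T.parent v) + 1 := by
  obtain ⟨h, h1⟩ := T.exists_pathToRoot_eq_cons hv
  rw [depth, h1]
  rfl

theorem parent_induction {P : T.V → Prop} (root : P T.root)
    (step : ∀ v, v ≠ T.root → P (T.parent v) → P v) (v : T.V) : P v := by
  induction hn : T.depth v generalizing v with
  | zero =>
    by_cases hv : v = T.root
    · rw [hv]; exact root
    · have := T.depth_eq hv; omega
  | succ n ih =>
    by_cases hv : v = T.root
    · rw [hv]; exact root
    · exact step v hv (ih _ (by have := T.depth_eq hv; omega))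

theorem depth_iterate_le (v : T.V) (n : ℕ) : T.depth (T.parent^[n] v) ≤ T.depth v := by
  induction n with
  | zero => exact le_rfl
  | succ n ih =>
    rw [Function.iterate_succ_apply']
    refine le_trans ?_ ih
    by_cases h : T.parent^[n] v = T.root
    · rw [h, parent_root]
    · have := T.depth_eq h; omega

/-- The vertices of a tree are ordered by descent, with the root on top. -/
instance : PartialOrder T.V where
  le u v := ∃ n, T.parent^[n] u = v
  le_refl u := ⟨0, rfl⟩
  le_trans := by
    rintro u v w ⟨m, rfl⟩ ⟨n, rfl⟩
    exact ⟨n + m, Function.iterate_add_apply _ _ _ _⟩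
  le_antisymm := by
    rintro u v ⟨m, rfl⟩ ⟨n, hn⟩
    cases m with
    | zero => rfl
    | succ m =>
      by_cases hu : u = T.root
      · rw [hu]
        exact (Function.iterate_fixed T.parent_root _).symm
      · rw [Function.iterate_succ_apply] at hn
        have h1 := T.depth_iterate_le (T.parent^[m] (T.parent u)) n
        have h2 := T.depth_iterate_le (T.parent u) m
        have h3 := T.depth_eq hu
        rw [hn] at h1
        omega

variable {T}

theorem le_parent (v : T.V) : v ≤ T.parent v := ⟨1, rfl⟩

theorem le_root (v : T.V) : v ≤ T.root := by
  induction v using T.parent_induction with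
  | root => exact le_rfl
  | step v hv ih => exact (le_parent v).trans ih

theorem parent_le_of_lt {u v : T.V} (h : u < v) : T.parent u ≤ v := by
  obtain ⟨n, rfl⟩ := h.le
  cases n with
  | zero => exact absurd h (lt_irrefl _)
  | succ n => exact ⟨n, by rw [Function.iterate_succ_apply]⟩

theorem lt_parent {v : T.V} (hv : v ≠ T.root) : v < T.parent v :=
  lt_of_le_of_ne (le_parent v) (T.parent_ne hv).symm

theorem ne_root_of_lt {u v : T.V} (h : u < v) : u ≠ T.root := by
  rintro rfl
  exact absurd (le_root v) h.not_ge

theorem le_total_of_le {u v w : T.V} (hv : u ≤ v) (hw : u ≤ w) : v ≤ w ∨ w ≤ v := by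
  obtain ⟨m, rfl⟩ := hv
  obtain ⟨n, rfl⟩ := hw
  rcases le_total m n with h | h
  · left
    exact ⟨n - m, by rw [← Function.iterate_add_apply, Nat.sub_add_cancel h]⟩
  · right
    exact ⟨m - n, by rw [← Function.iterate_add_apply, Nat.sub_add_cancel h]⟩

theorem mem_support_pathToRoot {u v : T.V} : v ∈ (T.pathToRoot u).support ↔ u ≤ v := by
  induction u using T.parent_induction with
  | root =>
    rw [← T.eq_pathToRoot (p := SimpleGraph.Walk.nil) SimpleGraph.Walk.IsPath.nil]
    simp only [SimpleGraph.Walk.support_nil, List.mem_singleton]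
    exact ⟨fun h => h.ge, fun h => le_antisymm (le_root v) h⟩
  | step u hu ih =>
    obtain ⟨h, h1⟩ := T.exists_pathToRoot_eq_cons hu
    rw [h1, SimpleGraph.Walk.support_cons, List.mem_cons, ih]
    constructor
    · rintro (rfl | h2)
      · exact le_rfl
      · exact (le_parent u).trans h2
    · intro h2
      rcases h2.eq_or_lt with rfl | h3
      · exact Or.inl rfl
      · exact Or.inr (parent_le_of_lt h3)

theorem isAncestor_iff {v w : T.V} : IsAncestor T.graph T.root w v ↔ v < w := by
  rw [lt_iff_le_and_ne, and_comm]
  refine and_congr_right fun _ => ?_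
  rw [← mem_support_pathToRoot]
  constructor
  · rintro ⟨p, hp, hw⟩
    rwa [← T.eq_pathToRoot hp]
  · exact fun h => ⟨_, T.isPath_pathToRoot v, h⟩

theorem adj_iff {u v : T.V} : T.graph.Adj u v ↔ u ≠ v ∧ (T.parent u = v ∨ T.parent v = u) := by
  constructor
  · intro h
    refine ⟨h.ne, ?_⟩
    by_cases hu : u ∈ (T.pathToRoot v).support
    · right
      exact (T.isTree.2.eq_snd_of_adj_start (T.isPath_pathToRoot v) h.symm hu).symm
    · left
      exact (T.pathToRoot_cons (h := h) ((T.isPath_pathToRoot v).cons hu)).1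
  · rintro ⟨hne, rfl | rfl⟩
    · exact T.adj_parent fun h => hne (by rw [h, parent_root])
    · exact (T.adj_parent fun h => hne (by rw [h, parent_root])).symm

theorem isChild_iff {v w : T.V} : IsChild T.graph T.root v w ↔ v ≠ T.root ∧ T.parent v = w := by
  rw [IsChild, isAncestor_iff, adj_iff]
  constructor
  · rintro ⟨hlt, hne, h | rfl⟩
    · exact ⟨ne_root_of_lt hlt, h⟩
    · exact absurd (le_parent w) hlt.not_ge
  · rintro ⟨hv, rfl⟩
    exact ⟨lt_parent hv, (T.parent_ne hv).symm, Or.inl rfl⟩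

theorem stable_parent (T : LabeledTree S) (v : T.V) :
    2 ≤ {w | w ≠ T.root ∧ T.parent w = v}.ncard + (T.lb v).ncard := by
  simpa only [isChild_iff] using T.stable v

/-- An edge that leaves the set of vertices below `a` is the edge from `a` to its parent. -/
theorem eq_of_adj_of_le_of_not_le {a p q : T.V} (h : T.graph.Adj p q) (hp : p ≤ a)
    (hq : ¬ q ≤ a) : p = a ∧ q = T.parent a := by
  rcases (adj_iff.1 h).2 with rfl | rfl
  · rcases hp.eq_or_lt with rfl | hlt
    · exact ⟨rfl, rfl⟩
    · exact absurd (parent_le_of_lt hlt) hq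
  · exact absurd ((le_parent q).trans hp) hq

/-- The labels of a vertex and its descendants. -/
def clade (T : LabeledTree S) (v : T.V) : Set S := {s | ∃ u ≤ v, s ∈ T.lb u}

theorem clade_mono {u v : T.V} (h : u ≤ v) : T.clade u ⊆ T.clade v :=
  fun _ ⟨w, hw, hs⟩ => ⟨w, hw.trans h, hs⟩

theorem clade_nonempty (v : T.V) : (T.clade v).Nonempty := by
  induction v using WellFoundedLT.induction with
  | ind v ih =>
    rcases (T.lb v).eq_empty_or_nonempty with h | ⟨s, hs⟩
    · have := T.stable_parent v
      rw [h, Set.ncard_empty] at this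
      obtain ⟨w, hw, rfl⟩ := Set.nonempty_of_ncard_ne_zero
        (s := {w | w ≠ T.root ∧ T.parent w = v}) (by omega)
      exact (ih w (lt_parent hw)).mono (clade_mono (le_parent w))
    · exact ⟨s, v, le_rfl, hs⟩

theorem eq_of_mem_lb {s : S} {u v : T.V} (hu : s ∈ T.lb u) (hv : s ∈ T.lb v) : u = v := by
  by_contra h
  exact Set.disjoint_left.1 (T.lb_disjoint u v h) hu hv

/-- The parent of a vertex of a tree that is given by a parent function. -/
theorem parent_eq_of_adj_iff {f : T.V → T.V} (hroot : f T.root = T.root)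
    (hf : ∀ u v, T.graph.Adj u v ↔ u ≠ v ∧ (f u = v ∨ f v = u)) (v : T.V) :
    T.parent v = f v := by
  induction v using T.parent_induction with
  | root => rw [parent_root, hroot]
  | step v hv ih =>
    rcases ((hf _ _).1 (T.adj_parent hv)).2 with h | h
    · exact h.symm
    · rw [h] at ih
      have hpv : T.parent v ≠ T.root := fun h' => hv (by rw [← h, h', hroot])
      exact absurd ((lt_parent hv).trans (lt_parent hpv)) (by rw [ih]; exact lt_irrefl _)

end LabeledTree

/-- A parent function defines a tree. -/
theorem isTree_of_parent {V : Type*} [Finite V] {G : SimpleGraph V} {r : V} {f : V → V}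
    (hf : ∀ u v, G.Adj u v ↔ u ≠ v ∧ (f u = v ∨ f v = u)) (d : V → ℕ)
    (hd : ∀ v, v ≠ r → d (f v) < d v) (hr : f r = r) : G.IsTree := by
  classical
  have hne : ∀ v, v ≠ r → f v ≠ v := fun v hv h => (hd v hv).ne (by rw [h])
  have hadj : ∀ v, v ≠ r → G.Adj v (f v) := fun v hv => (hf _ _).2 ⟨(hne v hv).symm, Or.inl rfl⟩
  have hreach : ∀ v, G.Reachable v r := by
    intro v
    induction hn : d v using Nat.strong_induction_on generalizing v with
    | _ n ih =>
    by_cases hv : v = r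
    · rw [hv]
    · exact (hadj v hv).reachable.trans (ih _ (hn ▸ hd v hv) _ rfl)
  rw [SimpleGraph.isTree_iff_connected_and_card]
  have : Nonempty V := ⟨r⟩
  refine ⟨⟨fun u v => (hreach u).trans (hreach v).symm⟩, ?_⟩
  -- Edges correspond to vertices other than the root, so a connected graph with this count is a
  -- tree. Injectivity holds because `d` drops strictly, so two vertices cannot be each other's
  -- parent.
  have e : {v // v ≠ r} ≃ G.edgeSet := Equiv.ofBijective
    (fun v => ⟨s(v.1, f v.1), hadj v.1 v.2⟩) ⟨fun u v h => ?_, fun e => ?_⟩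
  · have := Nat.card_congr e
    rw [← this]
    have h2 := Nat.card_congr (Equiv.sumCompl (· = r))
    rw [Nat.card_sum] at h2
    rw [← h2]
    simp [add_comm]
  · have h' : s(u.1, f u.1) = s(v.1, f v.1) := congrArg Subtype.val h
    rcases Sym2.eq_iff.1 h' with ⟨h1, -⟩ | ⟨h1, h2⟩
    · exact Subtype.ext h1
    · have h3 := hd u.1 u.2
      have h4 := hd v.1 v.2
      rw [h2] at h3
      rw [← h1] at h4
      omega
  · obtain ⟨e, he⟩ := e
    induction e with
    | _ u v =>
    obtain ⟨hne, h | h⟩ := (hf u v).1 he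
    · exact ⟨⟨u, fun hu => hne (by rw [← h, hu, hr])⟩, Subtype.ext (by simp [h])⟩
    · exact ⟨⟨v, fun hu => hne (by rw [← h, hu, hr])⟩, Subtype.ext (by simp [h, Sym2.eq_swap])⟩

end RBW

/-! ### Contractions: monotonicity, uniqueness and factorization. -/

namespace RBW

universe u

variable {S : Type u}

namespace Contraction

open LabeledTree

variable {T T' T'' : LabeledTree S}

/-- One inclusion of labels suffices: the labels of `T` exhaust `S` and those of `T'` are disjoint.
-/
theorem exists_of_map (m : T.V → T'.V) (hs : Function.Surjective m)
    (H : SimpleGraph T.V) (hH : H ≤ T.graph) (hm : ∀ u v, m u = m v ↔ H.Reachable u v)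
    (hadj : ∀ a b, T'.graph.Adj a b ↔ a ≠ b ∧ ∃ u v, T.graph.Adj u v ∧ m u = a ∧ m v = b)
    (hroot : m T.root = T'.root) (hlb : ∀ v s, s ∈ T.lb v → s ∈ T'.lb (m v)) :
    ∃ c : Contraction T T', c.map = m := by
  refine ⟨⟨H.edgeSet, SimpleGraph.edgeSet_mono hH, m, hs, ?_, hadj, hroot, fun w => ?_⟩, rfl⟩
  · simpa using hm
  · ext s
    simp only [Set.mem_ofPred_eq, Set.mem_iUnion, exists_prop]
    constructor
    · intro h
      obtain ⟨v, hv⟩ := Set.mem_iUnion.1 (T.lb_cover.ge (Set.mem_univ s))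
      exact ⟨v, eq_of_mem_lb (hlb v s hv) h, hv⟩
    · rintro ⟨v, rfl, hv⟩
      exact hlb v s hv

theorem mem_lb_map (c : Contraction T T') {s : S} {v : T.V} (h : s ∈ T.lb v) :
    s ∈ T'.lb (c.map v) := by
  rw [c.lb_eq]
  exact Set.mem_biUnion (x := v) rfl h

/-- If a fiber has vertices below `a` and others, then it contains `a` and its parent. -/
theorem map_eq_of_le_of_not_le (c : Contraction T T') {x y a : T.V} (h : c.map x = c.map y)
    (hx : x ≤ a) (hy : ¬ y ≤ a) : c.map a = c.map x ∧ c.map (T.parent a) = c.map x := by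
  obtain ⟨p⟩ := (c.map_eq_iff x y).1 h
  obtain ⟨d, hd, h1, h2⟩ := p.exists_boundary_dart {u | u ≤ a} hx hy
  have hadj := d.adj
  rw [SimpleGraph.fromEdgeSet_adj] at hadj
  obtain ⟨h3, h4⟩ := eq_of_adj_of_le_of_not_le (c.edges_subset hadj.1) h1 h2
  have h6 := (c.map_eq_iff _ _).2 d.adj.reachable
  change c.map d.fst = c.map d.snd at h6
  change d.fst = a at h3
  change d.snd = T.parent a at h4
  have h5 : c.map a = c.map x := by
    rw [eq_comm, c.map_eq_iff, ← h3]
    classical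
    exact ⟨p.takeUntil _ (p.dart_fst_mem_support_of_mem_darts hd)⟩
  exact ⟨h5, by rw [← h4, ← h6, h3, h5]⟩

theorem map_parent (c : Contraction T T') (v : T.V) :
    c.map (T.parent v) = c.map v ∨ c.map (T.parent v) = T'.parent (c.map v) := by
  by_cases hne : c.map (T.parent v) = c.map v
  · exact Or.inl hne
  have hv : v ≠ T.root := by
    rintro rfl
    exact hne (by rw [parent_root])
  have h1 := (c.adj_iff (c.map v) (c.map (T.parent v))).2
    ⟨fun h => hne h.symm, _, _, T.adj_parent hv, rfl, rfl⟩
  rcases (LabeledTree.adj_iff.1 h1).2 with h2 | h2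
  · exact Or.inr h2.symm
  -- otherwise a vertex above the parent of `v` lies in the fiber of `v`
  have key : ∀ u : T.V, c.map u ≤ c.map (T.parent v) →
      ∃ x, u ≤ x ∧ c.map x = T'.parent (c.map (T.parent v)) := by
    intro u
    induction u using T.parent_induction with
    | root =>
      intro h
      refine ⟨T.root, le_rfl, ?_⟩
      rw [c.map_root] at h ⊢
      rw [← h.antisymm (le_root _), parent_root]
    | step u hu ih =>
      intro h
      by_cases h3 : c.map (T.parent u) ≤ c.map (T.parent v)
      · obtain ⟨x, hx, hx'⟩ := ih h3
        exact ⟨x, (le_parent u).trans hx, hx'⟩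
      · have h4 := (c.adj_iff (c.map u) (c.map (T.parent u))).2
          ⟨fun h' => h3 (h' ▸ h), _, _, T.adj_parent hu, rfl, rfl⟩
        exact ⟨_, le_parent u, (eq_of_adj_of_le_of_not_le h4 h h3).2⟩
  obtain ⟨x, hx, hx'⟩ := key _ le_rfl
  rw [h2] at hx'
  exact Or.inl (c.map_eq_of_le_of_not_le hx'.symm le_rfl
    ((lt_parent hv).trans_le hx).not_ge).2

theorem map_mono (c : Contraction T T') : Monotone c.map := by
  rintro u v ⟨n, rfl⟩
  induction n with
  | zero => exact le_rfl
  | succ n ih =>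
    rw [Function.iterate_succ_apply']
    rcases c.map_parent (T.parent^[n] u) with h | h
    · rw [h]; exact ih
    · rw [h]; exact ih.trans (le_parent _)

/-- On the way from `u` to the root the image rises by at most one step at a time, so it skips no
vertex. -/
theorem exists_le_map_eq (c : Contraction T T') {u : T.V} {w : T'.V} (h : c.map u ≤ w) :
    ∃ x, u ≤ x ∧ c.map x = w := by
  induction u using T.parent_induction with
  | root =>
    rw [c.map_root] at h
    exact ⟨_, le_rfl, c.map_root.trans (h.antisymm (le_root _))⟩
  | step u hu ih =>
    rcases h.eq_or_lt with rfl | hlt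
    · exact ⟨u, le_rfl, rfl⟩
    · have h2 : c.map (T.parent u) ≤ w := by
        rcases c.map_parent u with h' | h'
        · rw [h']; exact h
        · rw [h']; exact parent_le_of_lt hlt
      obtain ⟨x, hx, hx'⟩ := ih h2
      exact ⟨x, (le_parent u).trans hx, hx'⟩

theorem clade_subset_clade_map (c : Contraction T T') (v : T.V) :
    T.clade v ⊆ T'.clade (c.map v) :=
  fun _ ⟨u, hu, hs⟩ => ⟨c.map u, c.map_mono hu, c.mem_lb_map hs⟩

/-- The image of `v` is the least vertex whose clade contains the clade of `v`. -/
theorem map_le_of_clade_subset (c : Contraction T T') {v : T.V} {w : T'.V}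
    (h : T.clade v ⊆ T'.clade w) : c.map v ≤ w := by
  have hlab : ∀ u ≤ v, ∀ s ∈ T.lb u, c.map u ≤ w := by
    intro u hu s hs
    obtain ⟨x, hx, hsx⟩ := h ⟨u, hu, hs⟩
    rwa [eq_of_mem_lb (c.mem_lb_map hs) hsx]
  by_contra hcon
  -- A label below the child `a` is carried below `w`. Climbing from its vertex reaches the fiber of
  -- `w`, and does so before `v`, since otherwise `c.map v ≤ w`.
  have hbelow : ∀ a, a ≠ T.root → T.parent a = v → ∃ x ≤ a, c.map x = w := by
    rintro a ha rfl
    obtain ⟨s, u, hu, hs⟩ := clade_nonempty a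
    obtain ⟨x, hx, hxw⟩ := c.exists_le_map_eq (hlab u (hu.trans (le_parent a)) s hs)
    refine ⟨x, ?_, hxw⟩
    by_contra hxa
    rcases le_total_of_le hu hx with h1 | h1
    · exact hcon (hxw ▸ c.map_mono (parent_le_of_lt (lt_of_le_not_ge h1 hxa)))
    · exact hxa h1
  have hlb : T.lb v = ∅ := Set.eq_empty_of_forall_notMem fun s hs => hcon (hlab v le_rfl s hs)
  have hst := T.stable_parent v
  rw [hlb, Set.ncard_empty, add_zero] at hst
  -- As `v` has no labels, stability gives two children. The fiber of `w` is connected and meets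
  -- both branches, so it contains `v`.
  obtain ⟨a, ⟨ha, hav⟩, b, ⟨hb, hbv⟩, hab⟩ := Set.one_lt_ncard_iff_nontrivial.1 hst
  obtain ⟨x, hxa, hx⟩ := hbelow a ha hav
  obtain ⟨y, hyb, hy⟩ := hbelow b hb hbv
  have hya : ¬ y ≤ a := by
    intro hya
    rcases le_total_of_le hya hyb with h1 | h1
    · exact absurd (parent_le_of_lt (lt_of_le_of_ne h1 hab)) (by
        rw [hav, ← hbv]; exact (lt_parent hb).not_ge)
    · exact absurd (parent_le_of_lt (lt_of_le_of_ne h1 hab.symm)) (by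
        rw [hbv, ← hav]; exact (lt_parent ha).not_ge)
  have h2 := (c.map_eq_of_le_of_not_le (hx.trans hy.symm) hxa hya).2
  rw [hav, hx] at h2
  exact hcon h2.le

/-- There is at most one contraction between two labeled trees. -/
theorem map_unique (c d : Contraction T T') : c.map = d.map :=
  funext fun v => le_antisymm (c.map_le_of_clade_subset (d.clade_subset_clade_map v))
    (d.map_le_of_clade_subset (c.clade_subset_clade_map v))

/-- Fibers are connected by contracted edges, each of which joins a vertex to its parent; so
constancy on fibers can be checked edge by edge. -/
theorem apply_eq_of_map_eq (c : Contraction T T') {α : Type*} {φ : T.V → α}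
    (h : ∀ v, v ≠ T.root → c.map v = c.map (T.parent v) → φ v = φ (T.parent v))
    {u v : T.V} (huv : c.map u = c.map v) : φ u = φ v := by
  obtain ⟨p⟩ := (c.map_eq_iff u v).1 huv
  clear huv
  induction p with
  | nil => rfl
  | @cons u w v hadj p ih =>
    rw [← ih]
    have h1 := (c.map_eq_iff u w).2 hadj.reachable
    rw [SimpleGraph.fromEdgeSet_adj] at hadj
    obtain ⟨hne, h2⟩ := LabeledTree.adj_iff.1 (c.edges_subset hadj.1)
    change u ≠ w at hne
    change T.parent u = w ∨ T.parent w = u at h2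
    rcases h2 with rfl | rfl
    · exact h u (fun hu => hne (by rw [hu, parent_root])) h1
    · exact (h w (fun hw => hne (by rw [hw, parent_root])) h1.symm).symm

theorem exists_comp_map (c : Contraction T T') (f : Contraction T' T'') :
    ∃ d : Contraction T T'', ∀ v, d.map v = f.map (c.map v) := by
  set H : SimpleGraph T.V :=
    { Adj := fun u v => T.graph.Adj u v ∧ f.map (c.map u) = f.map (c.map v)
      symm := ⟨fun a b hab => ⟨hab.1.symm, hab.2.symm⟩⟩
      loopless := ⟨fun a ha => ha.1.ne rfl⟩ } with hH
  have hle : SimpleGraph.fromEdgeSet c.edges ≤ H := by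
    intro u v huv
    have h1 := (c.map_eq_iff u v).2 huv.reachable
    rw [SimpleGraph.fromEdgeSet_adj] at huv
    exact ⟨c.edges_subset huv.1, by rw [h1]⟩
  have lift : ∀ a b, (SimpleGraph.fromEdgeSet f.edges).Reachable a b →
      ∀ u v, c.map u = a → c.map v = b → H.Reachable u v := by
    rintro a b ⟨p⟩
    induction p with
    | nil =>
      intro u v hu hv
      exact ((c.map_eq_iff u v).1 (hu.trans hv.symm)).mono hle
    | @cons a a' b hab p ih =>
      intro u v hu hv
      have h1 := (f.map_eq_iff _ _).2 hab.reachable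
      rw [SimpleGraph.fromEdgeSet_adj] at hab
      obtain ⟨-, x, y, hxy, rfl, rfl⟩ := (c.adj_iff _ _).1 (f.edges_subset hab.1)
      have h2 : H.Adj x y := ⟨hxy, h1⟩
      exact (((c.map_eq_iff u x).1 hu).mono hle).trans (h2.reachable.trans (ih y v rfl hv))
  suffices h : ∃ d : Contraction T T'', d.map = f.map ∘ c.map by
    obtain ⟨d, hd⟩ := h
    exact ⟨d, fun v => by rw [hd]; rfl⟩
  refine exists_of_map (f.map ∘ c.map)
    (f.map_surjective.comp c.map_surjective) H (fun _ _ h => h.1) (fun u v => ⟨fun h =>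
      lift _ _ ((f.map_eq_iff _ _).1 h) u v rfl rfl, ?_⟩) (fun a b => ⟨?_, ?_⟩)
    (by simp [c.map_root, f.map_root]) (fun v s hs => f.mem_lb_map (c.mem_lb_map hs))
  · rintro ⟨p⟩
    induction p with
    | nil => rfl
    | cons hadj p ih => exact hadj.2.trans ih
  · intro h
    obtain ⟨hne, x, y, hxy, rfl, rfl⟩ := (f.adj_iff _ _).1 h
    obtain ⟨-, u, v, huv, rfl, rfl⟩ := (c.adj_iff _ _).1 hxy
    exact ⟨hne, u, v, huv, rfl, rfl⟩
  · rintro ⟨hne, u, v, huv, rfl, rfl⟩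
    exact (f.adj_iff _ _).2 ⟨hne, c.map u, c.map v, (c.adj_iff _ _).2
      ⟨fun h => hne (congrArg f.map h), u, v, huv, rfl, rfl⟩, rfl, rfl⟩

/-- A contraction factors through any other that contracts fewer edges. -/
theorem exists_factor (c : Contraction T T') (d : Contraction T T'')
    (h : ∀ u v, c.map u = c.map v → d.map u = d.map v) :
    ∃ f : Contraction T' T'', ∀ v, f.map (c.map v) = d.map v := by
  choose σ hσ using c.map_surjective
  set m : T'.V → T''.V := fun a => d.map (σ a) with hm
  have hmc : ∀ v, m (c.map v) = d.map v := fun v => h _ _ (hσ _)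
  set H : SimpleGraph T'.V :=
    { Adj := fun a b => T'.graph.Adj a b ∧ m a = m b
      symm := ⟨fun a b hab => ⟨hab.1.symm, hab.2.symm⟩⟩
      loopless := ⟨fun a ha => ha.1.ne rfl⟩ } with hH
  suffices h : ∃ f : Contraction T' T'', f.map = m by
    obtain ⟨f, hf⟩ := h
    exact ⟨f, fun v => by rw [hf, hmc]⟩
  refine exists_of_map m (fun w => by
      obtain ⟨v, rfl⟩ := d.map_surjective w
      exact ⟨_, hmc v⟩) H (fun a b hab => hab.1) (fun a b => ?_) (fun a b => ?_) ?_ ?_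
  · constructor
    · intro hab
      obtain ⟨u, rfl⟩ := c.map_surjective a
      obtain ⟨v, rfl⟩ := c.map_surjective b
      rw [hmc, hmc, d.map_eq_iff] at hab
      obtain ⟨p⟩ := hab
      induction p with
      | nil => exact .refl _
      | @cons u w v hadj p ih =>
        refine SimpleGraph.Reachable.trans ?_ ih
        have h1 := (d.map_eq_iff u w).2 hadj.reachable
        rw [SimpleGraph.fromEdgeSet_adj] at hadj
        by_cases h2 : c.map u = c.map w
        · rw [h2]
        · have h3 : H.Adj (c.map u) (c.map w) :=
            ⟨(c.adj_iff _ _).2 ⟨h2, _, _, d.edges_subset hadj.1, rfl, rfl⟩, by rw [hmc, hmc, h1]⟩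
          exact h3.reachable
    · rintro ⟨p⟩
      induction p with
      | nil => rfl
      | cons hadj p ih => exact hadj.2.trans ih
  · rw [d.adj_iff]
    refine and_congr_right fun hne => ⟨?_, ?_⟩
    · rintro ⟨u, v, huv, rfl, rfl⟩
      refine ⟨c.map u, c.map v, (c.adj_iff _ _).2 ⟨fun h' => hne (h _ _ h'), u, v, huv, rfl, rfl⟩,
        hmc u, hmc v⟩
    · rintro ⟨x, y, hxy, rfl, rfl⟩
      obtain ⟨-, u, v, huv, rfl, rfl⟩ := (c.adj_iff _ _).1 hxy
      exact ⟨u, v, huv, (hmc u).symm, (hmc v).symm⟩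
  · rw [← c.map_root, hmc, d.map_root]
  · intro a s hs
    rw [c.lb_eq] at hs
    obtain ⟨v, rfl, hv⟩ : ∃ v, c.map v = a ∧ s ∈ T.lb v := by simpa using hs
    rw [hmc]
    exact d.mem_lb_map hv

end Contraction

namespace RBWContraction

open LabeledTree

variable {T T' T'' : RBWTree S}

theorem color_map_of_white (c : RBWContraction T T') {v : T.V} (hv : T.color v = .W) :
    T'.color (c.map v) = .W := by
  cases h : T'.color (c.map v) with
  | R => rw [c.red_fiber v h] at hv; cases hv
  | B => rw [c.blue_fiber v h] at hv; cases hv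
  | W => rfl

/-- The contractions of the target are the contractions of the source that contract
more edges and turn more vertices white. -/
theorem nonempty_iff (c : RBWContraction T T') (d : RBWContraction T T'') :
    Nonempty (RBWContraction T' T'') ↔
      (∀ v, v ≠ T.root → c.map v = c.map (T.parent v) → d.map v = d.map (T.parent v)) ∧
      ∀ v, T.color v ≠ .W → T'.color (c.map v) = .W → T''.color (d.map v) = .W := by
  constructor
  · rintro ⟨f⟩
    have hfc : ∀ v, d.map v = f.map (c.map v) := by
      obtain ⟨e, he⟩ := Contraction.exists_comp_map c.toContraction f.toContraction
      intro v
      rw [← he, d.toContraction.map_unique e]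
    refine ⟨fun v _ h => by rw [hfc, hfc, h], fun v _ h => ?_⟩
    rw [hfc]
    exact f.color_map_of_white h
  · rintro ⟨h1, h2⟩
    obtain ⟨f, hf⟩ := c.toContraction.exists_factor d.toContraction
      fun u v => c.toContraction.apply_eq_of_map_eq h1
    refine ⟨⟨f, fun a ha => ?_, fun a ha => ?_⟩⟩
    · obtain ⟨v, rfl⟩ := c.map_surjective a
      rw [hf] at ha
      have hv := d.red_fiber v ha
      cases h : T'.color (c.map v) with
      | R => rfl
      | B => rw [c.blue_fiber v h] at hv; cases hv
      | W => rw [h2 v (by rw [hv]; simp) h] at ha; cases ha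
    · obtain ⟨v, rfl⟩ := c.map_surjective a
      rw [hf] at ha
      have hv := d.blue_fiber v ha
      cases h : T'.color (c.map v) with
      | R => rw [c.red_fiber v h] at hv; cases hv
      | B => rfl
      | W => rw [h2 v (by rw [hv]; simp) h] at ha; cases ha

end RBWContraction

end RBW

/-! ### Existence of the contraction along any set of edges. -/

namespace RBW

universe u

variable {S : Type u}

namespace LabeledTree

theorem strictMono_of_lt_parent {T : LabeledTree S} {f : T.V → ℝ}
    (h : ∀ v, v ≠ T.root → f v < f (T.parent v)) : StrictMono f := by
  intro u w huw
  induction u using T.parent_induction with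
  | root => exact absurd (le_root w) huw.not_ge
  | step u hu ih =>
    rcases (parent_le_of_lt huw).eq_or_lt with h1 | h1
    · rw [← h1]; exact h u hu
    · exact (h u hu).trans (ih h1)

/-- The children in a tree that is given by a parent function. -/
theorem isChild_iff_of_adj_iff {V : Type} [Finite V] {G : SimpleGraph V} (hG : G.IsTree) {r : V}
    {f : V → V} (hroot : f r = r) (hf : ∀ u v, G.Adj u v ↔ u ≠ v ∧ (f u = v ∨ f v = u)) (v w : V) :
    IsChild G r v w ↔ v ≠ r ∧ f v = w := by
  -- Two artificial labels at every vertex make any tree stable, so the results on labeled trees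
  -- apply to a bare one.
  let T : LabeledTree (V × Bool) :=
    { V := V
      finite_V := inferInstance
      graph := G
      isTree := hG
      root := r
      lb := fun v => {s | s.1 = v}
      lb_disjoint := fun v w hvw => Set.disjoint_left.2 fun s hs hs' => hvw (hs.symm.trans hs')
      lb_cover := Set.eq_univ_of_forall fun s => Set.mem_iUnion.2 ⟨s.1, rfl⟩
      stable := fun v => by
        refine le_add_left ?_
        have h : ({(v, true), (v, false)} : Set (V × Bool)).ncard = 2 := Set.ncard_pair (by simp)
        rw [← h]
        refine Set.ncard_le_ncard ?_ (Set.toFinite _)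
        rintro s (rfl | rfl) <;> rfl }
  have h := isChild_iff (T := T) (v := v) (w := w)
  rw [parent_eq_of_adj_iff (T := T) hroot hf v] at h
  exact h

open Classical in
/-- The first vertex on the path from `v` to the root that is the root or does not satisfy `P`. -/
noncomputable def collapse (T : LabeledTree S) (P : T.V → Prop) (v : T.V) : T.V :=
  if _h : v ≠ T.root ∧ P v then T.collapse P (T.parent v) else v
termination_by T.depth v
decreasing_by
  have := T.depth_eq _h.1
  omega

variable {T : LabeledTree S} {P : T.V → Prop}

theorem collapse_of_pos {v : T.V} (hv : v ≠ T.root) (h : P v) :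
    T.collapse P v = T.collapse P (T.parent v) := by
  rw [collapse, dif_pos ⟨hv, h⟩]

theorem collapse_of_neg {v : T.V} (h : v = T.root ∨ ¬ P v) : T.collapse P v = v := by
  rw [collapse, dif_neg (by tauto)]

theorem collapse_spec (v : T.V) : T.collapse P v = T.root ∨ ¬ P (T.collapse P v) := by
  induction v using T.parent_induction with
  | root => left; rw [collapse_of_neg (Or.inl rfl)]
  | step v hv ih =>
    by_cases h : P v
    · rwa [collapse_of_pos hv h]
    · rw [collapse_of_neg (Or.inr h)]; exact Or.inr h

theorem le_collapse (v : T.V) : v ≤ T.collapse P v := by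
  induction v using T.parent_induction with
  | root => rw [collapse_of_neg (Or.inl rfl)]
  | step v hv ih =>
    by_cases h : P v
    · rw [collapse_of_pos hv h]
      exact (le_parent v).trans ih
    · rw [collapse_of_neg (Or.inr h)]

theorem depth_le_of_le {u v : T.V} (h : u ≤ v) : T.depth v ≤ T.depth u := by
  obtain ⟨n, rfl⟩ := h
  exact T.depth_iterate_le u n

/-- Any set of edges can be contracted; here an edge is given by its lower vertex. -/
theorem exists_contraction [Finite S] (T : LabeledTree S) (P : T.V → Prop) :
    ∃ (T' : LabeledTree S) (c : Contraction T T'),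
      ∀ v, v ≠ T.root → (c.map v = c.map (T.parent v) ↔ P v) := by
  -- Each contracted component is represented by its top vertex: the root or a vertex whose upward
  -- edge is kept.
  let V' : Type := {v : T.V // v = T.root ∨ ¬ P v}
  let m : T.V → V' := fun v => ⟨T.collapse P v, collapse_spec v⟩
  have hm : ∀ k : V', m k = k := fun k => Subtype.ext (collapse_of_neg k.2)
  have mpos : ∀ v, v ≠ T.root → P v → m v = m (T.parent v) := fun v hv h =>
    Subtype.ext (collapse_of_pos hv h)
  have mneg : ∀ v, ¬ P v → (m v : T.V) = v := fun v h => collapse_of_neg (Or.inr h)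
  let r : V' := ⟨T.root, Or.inl rfl⟩
  let f : V' → V' := fun k => m (T.parent k)
  have hfr : f r = r := by
    change m (T.parent T.root) = r
    rw [parent_root]
    exact hm r
  let G : SimpleGraph V' :=
    { Adj := fun u v => u ≠ v ∧ (f u = v ∨ f v = u)
      symm := ⟨fun u v h => ⟨h.1.symm, h.2.symm⟩⟩
      loopless := ⟨fun u h => h.1 rfl⟩ }
  have hG : ∀ u v, G.Adj u v ↔ u ≠ v ∧ (f u = v ∨ f v = u) := fun u v => Iff.rfl
  have hne : ∀ k : V', k ≠ r → (k : T.V) ≠ T.root := fun k hk h => hk (Subtype.ext h)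
  have htree : G.IsTree := isTree_of_parent hG (fun k => T.depth k) (fun k hk => by
    have h1 := T.depth_eq (hne k hk)
    have h2 : T.depth (f k) ≤ T.depth (T.parent k) := depth_le_of_le (le_collapse _)
    omega) hfr
  let T' : LabeledTree S :=
    { V := V'
      finite_V := inferInstance
      graph := G
      isTree := htree
      root := r
      lb := fun k => {s | ∃ v, m v = k ∧ s ∈ T.lb v}
      lb_disjoint := fun k l hkl => Set.disjoint_left.2 fun s => by
        rintro ⟨v, rfl, hv⟩ ⟨w, rfl, hw⟩
        exact hkl (by rw [eq_of_mem_lb hv hw])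
      lb_cover := Set.eq_univ_of_forall fun s => by
        obtain ⟨v, hv⟩ := Set.mem_iUnion.1 (T.lb_cover.ge (Set.mem_univ s))
        exact Set.mem_iUnion.2 ⟨m v, v, rfl, hv⟩
      stable := fun k => by
        -- No edge below a lowest vertex `v` of the component is contracted, so the component keeps
        -- all children and labels of `v`, hence at least two. Finiteness of `S` makes `ncard`
        -- monotone here.
        obtain ⟨v, hv⟩ := (Set.toFinite {v | m v = k}).exists_minimal ⟨k, hm k⟩
        refine (T.stable_parent v).trans (add_le_add ?_ ?_)
        · simp only [isChild_iff_of_adj_iff htree hfr hG]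
          rw [← Set.ncard_image_of_injective _
            (Subtype.val_injective (p := fun v => v = T.root ∨ ¬ P v))]
          refine Set.ncard_le_ncard ?_ (Set.toFinite _)
          rintro w ⟨hw, rfl⟩
          have hPw : ¬ P w := fun h => (lt_parent hw).not_ge
            (hv.2 ((mpos w hw h).trans hv.1) (le_parent w))
          exact ⟨⟨w, Or.inr hPw⟩, ⟨fun h => hw (congrArg Subtype.val h), hv.1⟩, rfl⟩
        · exact Set.ncard_le_ncard (fun s hs => ⟨v, hv.1, hs⟩) (Set.toFinite _) }
  let H : SimpleGraph T.V :=
    { Adj := fun u v => T.graph.Adj u v ∧ m u = m v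
      symm := ⟨fun a b hab => ⟨hab.1.symm, hab.2.symm⟩⟩
      loopless := ⟨fun a ha => ha.1.ne rfl⟩ }
  have hreach : ∀ v, H.Reachable v (m v) := by
    intro v
    induction v using T.parent_induction with
    | root =>
      have : (m T.root : T.V) = T.root := collapse_of_neg (Or.inl rfl)
      rw [this]
    | step v hv ih =>
      by_cases h : P v
      · have h1 : H.Adj v (T.parent v) := ⟨T.adj_parent hv, mpos v hv h⟩
        rw [mpos v hv h]
        exact h1.reachable.trans ih
      · rw [mneg v h]
  have hreach' : ∀ u v, H.Reachable u v → m u = m v := by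
    rintro u v ⟨p⟩
    induction p with
    | nil => rfl
    | cons h p ih => exact h.2.trans ih
  have hadj : ∀ u v, T.parent u = v → m u ≠ m v → f (m u) = m v := by
    rintro u v rfl hne
    have hu : u ≠ T.root := by
      rintro rfl
      exact hne (by rw [parent_root])
    change m (T.parent (m u)) = _
    rw [mneg u fun h => hne (mpos u hu h)]
  obtain ⟨c, hc⟩ := Contraction.exists_of_map (T := T) (T' := T') m (fun k => ⟨k, hm k⟩) H
    (fun _ _ h => h.1)
    (fun u v => ⟨fun h => (hreach u).trans (by rw [h]; exact (hreach v).symm), hreach' u v⟩)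
    (fun a b => ⟨by
      rintro ⟨hne, h | h⟩
      · refine ⟨hne, a, T.parent a, T.adj_parent fun h' => hne ?_, hm a, h⟩
        obtain rfl : a = r := Subtype.ext h'
        rw [← h, hfr]
      · refine ⟨hne, T.parent b, b, (T.adj_parent fun h' => hne ?_).symm, h, hm b⟩
        obtain rfl : b = r := Subtype.ext h'
        rw [← h, hfr], by
      rintro ⟨hne, u, v, huv, rfl, rfl⟩
      refine ⟨hne, ?_⟩
      rcases (LabeledTree.adj_iff.1 huv).2 with h | h
      · exact Or.inl (hadj u v h hne)
      · exact Or.inr (hadj v u h hne.symm)⟩)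
    (hm r) (fun v s hs => ⟨v, rfl, hs⟩)
  refine ⟨T', c, fun v hv => ?_⟩
  rw [hc]
  refine ⟨fun h => ?_, mpos v hv⟩
  by_contra hP
  have h1 : T.parent v ≤ m (T.parent v) := le_collapse _
  rw [← h, mneg v hP] at h1
  exact (lt_parent hv).not_ge h1

end LabeledTree

end RBW

/-! ### The cone of heights and its faces. -/

namespace RBW

universe u

variable {S : Type u}

open scoped InnerProductSpace
open LabeledTree PolyhedralCone

namespace RBWTree

variable (T : RBWTree S)

/-- The red and blue vertices. -/
abbrev Nonwhite : Type := {v : T.V // T.color v ≠ .W}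

noncomputable instance : Fintype T.Nonwhite := Fintype.ofFinite _

open Classical in
/-- The vector representing the coordinate function of `v`, which is zero at white vertices. -/
noncomputable def coord (v : T.V) : EuclideanSpace ℝ T.Nonwhite :=
  if h : T.color v ≠ .W then EuclideanSpace.single ⟨v, h⟩ 1 else 0

/-- The height of the vertex `v` in the assignment `h` of heights to the red and blue vertices;
white vertices have height zero. -/
noncomputable def height (h : EuclideanSpace ℝ T.Nonwhite) (v : T.V) : ℝ := ⟪T.coord v, h⟫_ℝ

/-- The inequalities between heights: vertices are at most as high as their parents,
blue vertices have nonnegative height and red vertices have nonpositive height. -/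
noncomputable def constraint :
    {v : T.V // v ≠ T.root} ⊕ T.Nonwhite → EuclideanSpace ℝ T.Nonwhite
  | .inl v => T.coord (T.parent v) - T.coord v
  | .inr v => open Classical in if T.color v = .B then T.coord v else -T.coord v

variable {T}

theorem height_of_white (h : EuclideanSpace ℝ T.Nonwhite) {v : T.V} (hv : T.color v = .W) :
    T.height h v = 0 := by
  rw [height, coord, dif_neg (by simpa using hv), inner_zero_left]

theorem height_of_nonwhite (h : EuclideanSpace ℝ T.Nonwhite) (v : T.Nonwhite) :
    T.height h v = h v := by
  classical
  rw [height, coord, dif_pos v.2, EuclideanSpace.inner_single_left]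
  simp

theorem height_injective {h k : EuclideanSpace ℝ T.Nonwhite}
    (hk : ∀ v, T.height h v = T.height k v) : h = k := by
  ext v
  rw [← height_of_nonwhite, hk, height_of_nonwhite]

theorem exists_height_eq (φ : T.V → ℝ) (hφ : ∀ v, T.color v = .W → φ v = 0) :
    ∃ h : EuclideanSpace ℝ T.Nonwhite, ∀ v, T.height h v = φ v := by
  refine ⟨WithLp.toLp 2 fun v => φ v, fun v => ?_⟩
  by_cases hv : T.color v = .W
  · rw [height_of_white _ hv, hφ v hv]
  · exact height_of_nonwhite _ ⟨v, hv⟩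

theorem mem_cone_iff {h : EuclideanSpace ℝ T.Nonwhite} :
    h ∈ cone T.constraint ↔ (∀ v, T.height h v ≤ T.height h (T.parent v)) ∧
      (∀ v, T.color v = .B → 0 ≤ T.height h v) ∧ ∀ v, T.color v = .R → T.height h v ≤ 0 := by
  constructor
  · intro hh
    refine ⟨fun v => ?_, fun v hv => ?_, fun v hv => ?_⟩
    · by_cases hv : v = T.root
      · rw [hv, parent_root]
      · have := hh (.inl ⟨v, hv⟩)
        rwa [constraint, inner_sub_left, sub_nonneg] at this
    · have := hh (.inr ⟨v, by simp [hv]⟩)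
      simpa [constraint, hv, height] using this
    · have := hh (.inr ⟨v, by simp [hv]⟩)
      simp only [constraint, hv, reduceCtorEq, if_false, inner_neg_left] at this
      simpa [height] using this
  · rintro ⟨h1, h2, h3⟩ (⟨v, hv⟩ | ⟨v, hv⟩)
    · rw [constraint, inner_sub_left, sub_nonneg]
      exact h1 v
    · cases hc : T.color v with
      | W => exact absurd hc hv
      | B => simpa [constraint, hc, height] using h2 v hc
      | R =>
        simp only [constraint, hc, reduceCtorEq, if_false, inner_neg_left]
        have := h3 v hc
        simpa [height] using this

theorem inl_mem_tight {h : EuclideanSpace ℝ T.Nonwhite} {v : {v : T.V // v ≠ T.root}} :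
    .inl v ∈ tight T.constraint h ↔ T.height h v = T.height h (T.parent v) := by
  simp only [tight, Set.mem_ofPred_eq, constraint, inner_sub_left, sub_eq_zero]
  exact eq_comm

theorem inr_mem_tight {h : EuclideanSpace ℝ T.Nonwhite} {v : T.Nonwhite} :
    .inr v ∈ tight T.constraint h ↔ T.height h v = 0 := by
  simp only [tight, Set.mem_ofPred_eq, constraint]
  split_ifs
  · exact Iff.rfl
  · rw [inner_neg_left, neg_eq_zero]
    exact Iff.rfl

theorem eq_zero_of_tight_eq_univ (h : EuclideanSpace ℝ T.Nonwhite)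
    (hh : tight T.constraint h = Set.univ) : h = 0 := by
  ext v
  rw [← height_of_nonwhite, inr_mem_tight.1 (hh.ge (Set.mem_univ _))]
  simp

/-- Every tree has strictly monotone heights that are positive at blue vertices, zero at white
vertices and negative at red vertices. -/
theorem exists_strict_height (T : RBWTree S) : ∃ φ : T.V → ℝ,
    (∀ v, v ≠ T.root → φ v < φ (T.parent v)) ∧ (∀ v, T.color v = .B → 0 < φ v) ∧
    (∀ v, T.color v = .R → φ v < 0) ∧ ∀ v, T.color v = .W → φ v = 0 := by
  obtain ⟨M, hM⟩ := (Set.finite_range T.depth).bddAbove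
  have hM' : ∀ v, (T.depth v : ℝ) ≤ M := fun v => by exact_mod_cast hM ⟨v, rfl⟩
  -- Blue heights are at least 1 and red ones at most -1, and both drop with depth; the coloring
  -- rules settle the edges between different colors.
  let φ : T.V → ℝ := fun v => match T.color v with
    | .R => -(T.depth v : ℝ) - 1
    | .B => M + 1 - (T.depth v : ℝ)
    | .W => 0
  have hR : ∀ v, T.color v = .R → φ v = -(T.depth v : ℝ) - 1 := fun v hv => by simp [φ, hv]
  have hB : ∀ v, T.color v = .B → φ v = M + 1 - (T.depth v : ℝ) := fun v hv => by simp [φ, hv]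
  have hW : ∀ v, T.color v = .W → φ v = 0 := fun v hv => by simp [φ, hv]
  refine ⟨φ, fun v hv => ?_, fun v hv => ?_, fun v hv => ?_, hW⟩
  · have hd : (T.depth v : ℝ) = T.depth (T.parent v) + 1 := by exact_mod_cast T.depth_eq hv
    have hanc : IsAncestor T.graph T.root (T.parent v) v := isAncestor_iff.2 (lt_parent hv)
    have hnn : (0 : ℝ) ≤ T.depth (T.parent v) := Nat.cast_nonneg _
    have hMp := hM' (T.parent v)
    cases hp : T.color (T.parent v) with
    | R =>
      rw [hR _ (T.red_descendants _ _ hanc hp), hR _ hp]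
      linarith
    | B =>
      rw [hB _ hp]
      cases hc : T.color v with
      | R => rw [hR _ hc]; linarith
      | B => rw [hB _ hc]; linarith
      | W => rw [hW _ hc]; linarith
    | W =>
      rw [hW _ hp]
      cases hc : T.color v with
      | R => rw [hR _ hc]; linarith
      | B => rw [T.blue_ancestors _ _ hanc hc] at hp; cases hp
      | W => exact absurd ⟨hp, hc⟩ (T.white_incomparable _ _ hanc)
  · rw [hB v hv]
    linarith [hM' v]
  · rw [hR v hv]
    have : (0 : ℝ) ≤ T.depth v := Nat.cast_nonneg _
    linarith

theorem finrank_euclideanSpace_nonwhite (T : RBWTree S) :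
    Module.finrank ℝ (EuclideanSpace ℝ T.Nonwhite) = T.codim := by
  rw [finrank_euclideanSpace, ← Nat.card_eq_fintype_card, codim, ← Nat.card_coe_set_eq]
  refine Nat.card_congr (Equiv.subtypeEquivRight fun v => ?_)
  cases h : T.color v <;> simp [h]

end RBWTree

namespace RBWContraction

open RBWTree

variable {T T' T'' : RBWTree S}

/-- The inequalities between heights that become equalities under a contraction. -/
def collapsed (c : RBWContraction T T') : Set ({v : T.V // v ≠ T.root} ⊕ T.Nonwhite) :=
  {e | Sum.elim (fun v : {v : T.V // v ≠ T.root} => c.map v = c.map (T.parent v))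
    (fun v : T.Nonwhite => T'.color (c.map v) = .W) e}

theorem nonempty_iff_collapsed (c : RBWContraction T T') (d : RBWContraction T T'') :
    Nonempty (RBWContraction T' T'') ↔ c.collapsed ⊆ d.collapsed := by
  rw [nonempty_iff c d]
  constructor
  · rintro ⟨h1, h2⟩ (v | v) hv
    · exact h1 v v.2 hv
    · exact h2 v v.2 hv
  · intro h
    exact ⟨fun v hv hc => h (a := .inl ⟨v, hv⟩) hc, fun v hv hc => h (a := .inr ⟨v, hv⟩) hc⟩

/-- Strict heights on `T'`, pulled back along `c`, are tight exactly on the contracted edges and on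
the vertices turned white. -/
theorem collapsed_mem_tightSets (c : RBWContraction T T') :
    c.collapsed ∈ tightSets T.constraint := by
  obtain ⟨φ, h1, h2, h3, h4⟩ := T'.exists_strict_height
  obtain ⟨h, hh⟩ := exists_height_eq (fun v => φ (c.map v)) fun v hv =>
    h4 _ (c.color_map_of_white hv)
  have hstep : ∀ v, c.map (T.parent v) ≠ c.map v → φ (c.map v) < φ (c.map (T.parent v)) := by
    intro v hv
    have h5 := (c.map_parent v).resolve_left hv
    rw [h5]
    exact h1 _ fun h6 => hv (by rw [h5, h6, parent_root])
  refine ⟨h, mem_cone_iff.2 ⟨fun v => ?_, fun v hv => ?_, fun v hv => ?_⟩, ?_⟩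
  · rw [hh, hh]
    by_cases hv : c.map (T.parent v) = c.map v
    · rw [hv]
    · exact (hstep v hv).le
  · rw [hh]
    cases hc : T'.color (c.map v) with
    | R => rw [c.red_fiber v hc] at hv; cases hv
    | B => exact (h2 _ hc).le
    | W => exact (h4 _ hc).ge
  · rw [hh]
    cases hc : T'.color (c.map v) with
    | R => exact (h3 _ hc).le
    | B => rw [c.blue_fiber v hc] at hv; cases hv
    | W => exact (h4 _ hc).le
  · ext (v | v)
    · rw [inl_mem_tight, hh, hh]
      change _ ↔ c.map v = c.map (T.parent v)
      refine ⟨fun h5 => ?_, fun h5 => by rw [h5]⟩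
      by_contra h6
      exact (hstep v fun h7 => h6 h7.symm).ne h5
    · rw [inr_mem_tight, hh]
      change _ ↔ T'.color (c.map v) = .W
      refine ⟨fun h5 => ?_, h4 _⟩
      cases hc : T'.color (c.map v) with
      | R => exact absurd h5 (h3 _ hc).ne
      | B => exact absurd h5 (h2 _ hc).ne'
      | W => rfl

/-- Contracting the edges of constant height leaves strictly monotone heights, and signs of strictly
monotone heights form a legal coloring. -/
theorem exists_collapsed_eq [Finite S] {σ : Set ({v : T.V // v ≠ T.root} ⊕ T.Nonwhite)}
    (hσ : σ ∈ tightSets T.constraint) :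
    ∃ (T' : RBWTree S) (c : RBWContraction T T'), c.collapsed = σ := by
  obtain ⟨h, hh, rfl⟩ := hσ
  obtain ⟨h1, h2, h3⟩ := mem_cone_iff.1 hh
  obtain ⟨T', c, hc⟩ := T.toLabeledTree.exists_contraction
    fun v => T.height h v = T.height h (T.parent v)
  choose s hs using c.map_surjective
  let φ : T'.V → ℝ := fun w => T.height h (s w)
  have hφ : ∀ v, φ (c.map v) = T.height h v := fun v =>
    c.apply_eq_of_map_eq (fun v hv h => (hc v hv).1 h) (hs (c.map v))
  have hmono : StrictMono φ := by
    refine strictMono_of_lt_parent fun w hw => ?_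
    -- The edge above a highest vertex of the fiber is not contracted, so the height rises strictly
    -- along it.
    obtain ⟨v, hv⟩ := (Set.toFinite {v | c.map v = w}).exists_maximal ⟨s w, hs w⟩
    obtain rfl : c.map v = w := hv.1
    have hvr : v ≠ T.root := by
      rintro rfl
      exact hw c.map_root
    have h4 : c.map (T.parent v) ≠ c.map v := fun h5 =>
      (lt_parent hvr).not_ge (hv.2 h5 (le_parent v))
    rw [← (c.map_parent v).resolve_left h4, hφ, hφ]
    exact lt_of_le_of_ne (h1 v) fun h5 => h4 ((hc v hvr).2 h5).symm
  classical
  let col : T'.V → Color := fun w => if φ w < 0 then .R else if 0 < φ w then .B else .W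
  have colR : ∀ w, col w = .R ↔ φ w < 0 := by
    intro w
    simp only [col]
    split_ifs <;> simp [*]
  have colB : ∀ w, col w = .B ↔ 0 < φ w := by
    intro w
    simp only [col]
    split_ifs with h4
    · simp [h4.le]
    all_goals simp [*]
  have colW : ∀ w, col w = .W ↔ φ w = 0 := by
    intro w
    simp only [col]
    split_ifs with h4 h5
    · simp [h4.ne]
    · simp [h5.ne']
    · simp only [true_iff]
      linarith
  let T₁ : RBWTree S :=
    { toLabeledTree := T'
      color := col
      red_descendants := fun v w hvw hv => by
        rw [colR] at hv ⊢
        exact (hmono (isAncestor_iff.1 hvw)).trans hv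
      blue_ancestors := fun v w hvw hv => by
        rw [colB] at hv ⊢
        exact hv.trans (hmono (isAncestor_iff.1 hvw))
      white_incomparable := fun v w hvw hv => by
        rw [colW, colW] at hv
        exact (hmono (isAncestor_iff.1 hvw)).ne (hv.2.trans hv.1.symm) }
  refine ⟨T₁, ⟨c, fun v hv => ?_, fun v hv => ?_⟩, ?_⟩
  · have hv' := (colR _).1 hv
    rw [hφ] at hv'
    cases h4 : T.color v with
    | R => rfl
    | B => exact absurd (h2 v h4) hv'.not_ge
    | W => exact absurd (height_of_white h h4) hv'.ne
  · have hv' := (colB _).1 hv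
    rw [hφ] at hv'
    cases h4 : T.color v with
    | R => exact absurd (h3 v h4) hv'.not_ge
    | B => rfl
    | W => exact absurd (height_of_white h h4) hv'.ne'
  · ext (v | v)
    · rw [inl_mem_tight]
      exact hc v v.2
    · rw [inr_mem_tight, ← hφ]
      exact colW _

/-- Pulling heights back along `c` identifies the heights on `T'` with the linear span of the face
of `c`: these are the heights constant on fibers and zero on the fibers of white vertices. -/
theorem finrank_orthogonal_collapsed (c : RBWContraction T T') :
    Module.finrank ℝ (Submodule.span ℝ (T.constraint '' c.collapsed))ᗮ = T'.codim := by
  have hex : ∀ h : EuclideanSpace ℝ T'.Nonwhite, ∃ k : EuclideanSpace ℝ T.Nonwhite,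
      ∀ v, T.height k v = T'.height h (c.map v) := fun h =>
    exists_height_eq _ fun v hv => height_of_white h (c.color_map_of_white hv)
  choose Φ hΦ using hex
  let Ψ : EuclideanSpace ℝ T'.Nonwhite →ₗ[ℝ] EuclideanSpace ℝ T.Nonwhite :=
    { toFun := Φ
      map_add' := fun h k => height_injective fun v => by
        rw [hΦ, height, height, inner_add_right, inner_add_right]
        change _ = T.height _ v + T.height _ v
        rw [hΦ, hΦ]
        rfl
      map_smul' := fun a h => height_injective fun v => by
        rw [hΦ, height, height, inner_smul_right, RingHom.id_apply, inner_smul_right]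
        change _ = a * T.height _ v
        rw [hΦ]
        rfl }
  have hinj : Function.Injective Ψ := by
    intro h k hk
    refine height_injective fun w => ?_
    obtain ⟨v, rfl⟩ := c.map_surjective w
    rw [← hΦ, ← hΦ]
    exact congrArg (fun x => T.height x v) hk
  rw [← T'.finrank_euclideanSpace_nonwhite, ← LinearMap.finrank_range_of_inj hinj]
  suffices h : (Submodule.span ℝ (T.constraint '' c.collapsed))ᗮ = LinearMap.range Ψ by rw [h]
  ext k
  have h1 : k ∈ (Submodule.span ℝ (T.constraint '' c.collapsed))ᗮ ↔
      c.collapsed ⊆ tight T.constraint k := by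
    rw [mem_orthogonal_span_image]
  rw [h1, LinearMap.mem_range]
  constructor
  · intro hk
    have hfib : ∀ u v, c.map u = c.map v → T.height k u = T.height k v := fun u v =>
      c.apply_eq_of_map_eq fun v hv h => inl_mem_tight.1 (hk (a := .inl ⟨v, hv⟩) h)
    choose s hs using c.map_surjective
    obtain ⟨h, hh⟩ := exists_height_eq (T := T') (fun w => T.height k (s w)) (by
      intro w hw
      by_cases h2 : T.color (s w) = .W
      · exact height_of_white k h2
      · refine inr_mem_tight.1 (hk (a := .inr ⟨s w, h2⟩) ?_)
        change T'.color (c.map (s w)) = .W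
        rw [hs, hw])
    refine ⟨h, height_injective fun v => ?_⟩
    change T.height (Φ h) v = _
    rw [hΦ, hh]
    exact hfib _ _ (hs _)
  · rintro ⟨h, rfl⟩ (v | v) hv
    · rw [inl_mem_tight]
      change T.height (Φ h) v = T.height (Φ h) _
      have hv' : c.map v = c.map (T.parent v) := hv
      rw [hΦ, hΦ, hv']
    · rw [inr_mem_tight]
      change T.height (Φ h) v = _
      rw [hΦ]
      exact height_of_white h hv

theorem exists_collapsed_eq_empty (T : RBWTree S) :
    ∃ c : RBWContraction T T, c.collapsed = ∅ := by
  obtain ⟨c, hc⟩ := Contraction.exists_of_map (T := T.toLabeledTree) (T' := T.toLabeledTree) id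
    Function.surjective_id ⊥ bot_le (fun u v => by simp)
    (fun a b => ⟨fun h => ⟨h.ne, a, b, h, rfl, rfl⟩,
      by rintro ⟨-, u, v, h, rfl, rfl⟩; exact h⟩) rfl (fun _ _ h => h)
  refine ⟨⟨c, fun v hv => ?_, fun v hv => ?_⟩, Set.eq_empty_of_forall_notMem ?_⟩
  · rwa [hc] at hv
  · rwa [hc] at hv
  · rintro (v | v) hv
    · change c.map v = c.map (T.parent v) at hv
      rw [hc] at hv
      exact T.parent_ne v.2 hv.symm
    · change T.color (c.map v) = .W at hv
      rw [hc] at hv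
      exact v.2 hv

theorem collapsed_nonempty (c : RBWContraction T T') (hc : ¬ c.IsTrivial) :
    c.collapsed.Nonempty := by
  rw [Set.nonempty_iff_ne_empty]
  intro h
  have hmem : ∀ e, e ∉ c.collapsed := fun e he => by rw [h] at he; exact he
  refine hc ⟨Set.eq_empty_of_forall_notMem fun e he => ?_, fun v => ?_⟩
  · induction e with
    | _ u v =>
    have hadj : T.graph.Adj u v := c.edges_subset he
    have h1 : c.map u = c.map v := (c.map_eq_iff u v).2
      ((SimpleGraph.fromEdgeSet_adj _).2 ⟨he, hadj.ne⟩ :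
        (SimpleGraph.fromEdgeSet c.edges).Adj u v).reachable
    have key : ∀ x y, x ≠ y → T.parent x = y → c.map x ≠ c.map y := by
      rintro x y hne rfl hxy
      exact hmem (.inl ⟨x, fun hx => hne (by rw [hx, parent_root])⟩) hxy
    obtain ⟨hne, h2 | h2⟩ := LabeledTree.adj_iff.1 hadj
    · exact key u v hne h2 h1
    · exact key v u hne.symm h2 h1.symm
  · by_cases hv : T.color v = .W
    · rw [hv, c.color_map_of_white hv]
    · cases h2 : T'.color (c.map v) with
      | R => rw [c.red_fiber v h2]
      | B => rw [c.blue_fiber v h2]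
      | W => exact absurd h2 (hmem (.inr ⟨v, hv⟩))

/-- The intermediate contractions correspond to the tight sets of the cone of heights. -/
theorem nonempty_orderIso_intermediate [Finite S] (c : RBWContraction T T') :
    Nonempty ({σ : Set ({v : T.V // v ≠ T.root} ⊕ T.Nonwhite) //
      σ ∈ tightSets T.constraint ∧ σ.Nonempty ∧ σ ⊆ c.collapsed} ≃o c.intermediate) := by
  choose Q d hd using fun (σ : {σ // σ ∈ tightSets T.constraint}) => exists_collapsed_eq σ.2
  obtain ⟨e, he⟩ := exists_collapsed_eq_empty T
  have mk_le : ∀ A B : RBWTree S, TreePoset.mk A ≤ TreePoset.mk B ↔ Nonempty (RBWContraction A B) :=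
    fun A B => Iff.rfl
  -- The identity of `T` makes nothing tight, so `A` contracts back to `T` iff `f` makes nothing
  -- tight.
  have lt_iff : ∀ {A : RBWTree S} (f : RBWContraction T A),
      TreePoset.mk T < TreePoset.mk A ↔ f.collapsed.Nonempty := by
    intro A f
    rw [lt_iff_le_not_ge, mk_le, mk_le, f.nonempty_iff_collapsed e, he, Set.subset_empty_iff,
      Set.nonempty_iff_ne_empty]
    exact and_iff_right ⟨f⟩
  let F : {σ : Set ({v : T.V // v ≠ T.root} ⊕ T.Nonwhite) //
      σ ∈ tightSets T.constraint ∧ σ.Nonempty ∧ σ ⊆ c.collapsed} ↪o c.intermediate :=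
    OrderEmbedding.ofMapLEIff (fun σ => ⟨TreePoset.mk (Q ⟨σ, σ.2.1⟩),
      (lt_iff (d ⟨σ, σ.2.1⟩)).2 (by rw [hd]; exact σ.2.2.1),
      (mk_le _ _).2 (((d ⟨σ, σ.2.1⟩).nonempty_iff_collapsed c).2 (by rw [hd]; exact σ.2.2.2))⟩)
      (fun σ τ => by
        change TreePoset.mk _ ≤ TreePoset.mk _ ↔ _
        rw [mk_le, (d ⟨σ, σ.2.1⟩).nonempty_iff_collapsed (d ⟨τ, τ.2.1⟩), hd, hd]
        exact Iff.rfl)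
  refine ⟨RelIso.ofSurjective F ?_⟩
  rintro ⟨A, hA⟩
  obtain ⟨A, rfl⟩ := Quotient.exists_rep A
  change TreePoset.mk T < TreePoset.mk A ∧ TreePoset.mk A ≤ TreePoset.mk T' at hA
  obtain ⟨hA1, hA2⟩ := hA
  obtain ⟨f⟩ := (mk_le _ _).1 hA1.le
  refine ⟨⟨f.collapsed, f.collapsed_mem_tightSets, (lt_iff f).1 hA1,
    (f.nonempty_iff_collapsed c).1 ((mk_le _ _).1 hA2)⟩, Subtype.ext ?_⟩
  change TreePoset.mk (Q ⟨f.collapsed, _⟩) = TreePoset.mk A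
  refine le_antisymm ?_ ?_
  · rw [mk_le, (d _).nonempty_iff_collapsed f, hd]
  · rw [mk_le, f.nonempty_iff_collapsed (d _), hd]

end RBWContraction

end RBW

/-! ### Conclusion. -/

theorem mainTheorem6 {S : Type*} [Finite S] (T T' : RBW.RBWTree S)
    (c : RBW.RBWContraction T T') (hc : ¬ c.IsTrivial) :
    ∃ (X : Type) (_ : TopologicalSpace X) (_ : T2Space X)
      (_ : Topology.CWComplex (Set.univ : Set X)) (n : ℕ),
      RBW.IsRegular (Set.univ : Set X) ∧
      Nonempty (RBW.FacePoset (Set.univ : Set X) ≃o c.intermediate) ∧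
      (n : ℤ) = c.codim - 1 ∧
      Nonempty (X ≃ₜ Metric.closedBall (0 : EuclideanSpace ℝ (Fin n)) 1) := by
  obtain ⟨e, he⟩ := RBW.RBWContraction.exists_collapsed_eq_empty T
  have h1 := c.finrank_orthogonal_collapsed
  have h2 := T.finrank_euclideanSpace_nonwhite
  -- A nontrivial contraction has a nonempty tight set, and a point with no tight inequality lies
  -- off the span of its face. Thus the natural subtraction in the dimension below is not truncated.
  have hlt : T'.codim < T.codim := by
    rw [← h1, ← h2]
    refine Submodule.finrank_lt fun htop => ?_
    obtain ⟨x, hx⟩ := c.collapsed_nonempty hc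
    obtain ⟨k, hk, hke⟩ := e.collapsed_mem_tightSets
    have h3 : k ∈ (Submodule.span ℝ (T.constraint '' c.collapsed))ᗮ := htop.ge trivial
    rw [PolyhedralCone.mem_orthogonal_span_image, hke, he] at h3
    exact h3 hx
  obtain ⟨X, t, t2, cw, hreg, ⟨f⟩, hX⟩ := PolyhedralCone.exists_regular_cwComplex
    RBW.RBWTree.eq_zero_of_tight_eq_univ (he ▸ e.collapsed_mem_tightSets)
    c.collapsed_mem_tightSets (c.collapsed_nonempty hc) (T.codim - T'.codim - 1) (by
      rw [h1, h2]; omega)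
  obtain ⟨g⟩ := c.nonempty_orderIso_intermediate
  refine ⟨X, t, t2, cw, _, hreg, ⟨f.trans g⟩, ?_, hX⟩
  rw [RBW.RBWContraction.codim]
  omega
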